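/- Let $n\ge 2$ and let $W$ be the Coxeter group of type $C_n$, realised as the group of signed permutations $w$ of $\{\pm2,\dots,\pm(n+1)\}$ (so $w(-i)=-w(i)$), with simple reflections $s_{1'}=(2,-2)$ and $s_i=(i,i+1)(-i,-(i+1))$ for $2\le i\le n$, and with length function $\ell$. Let $P=\langle s_2,\dots,s_n\rangle$ be its parabolic subgroup of type $A_{n-1}$, and let ${}^PW$ be the set of minimal length representatives of the cosets in $P\backslash W$, with the strong Bruhat order $<$. Write $\varnothing\in{}^PW$ for the identity. *Light leaves matrix.* The extended Bruhat graph has vertex set ${}^PW$. Whenever $\lambda,\lambda s_i\in{}^PW$ and $\lambda<\lambda s_i$, it has four edges labelled $i$: $\lambda\to\lambda s_i$ and $\lambda s_i\to\lambda$ of degree $0$, $\lambda\to\lambda$ of degree $1$, and $\lambda s_i\to\lambda s_i$ of degree $-1$. The degree of a path is the sum of the degrees of its edges. For each $\mu\in{}^PW$ fix a path $T^\mu$ of shortest possible length from $\varnothing$ to $\mu$. Let $\mathrm{Path}(\lambda,T^\mu)$ be the set of all paths from $\varnothing$ to $\lambda$ with the same sequence of edge labels as $T^\mu$, and put $\Delta_{\lambda,\mu}=\sum_{S\in\mathrm{Path}(\lambda,T^\mu)}q^{\deg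 S}\in\mathbb Z[q,q^{-1}]$. *Diagrams.* A (decorated) tangle has $n+1$ northern and $n+1$ southern vertices, numbered $1,\dots,n+1$ from left to right and joined in pairs by non-crossing strands. Strands that can be deformed to touch the left side of the frame may carry a bead, and several beads on one strand count as one. Let $e_i$ ($2\le i\le n$) be the tangle with an undecorated arc joining the vertices $i,i+1$ on the northern and on the southern boundary and with undecorated vertical strands elsewhere. Let $e_{1'}$ be the similar tangle with arcs at the vertices $1,2$, both arcs carrying a bead. In a product $DD'$ the tangle $D'$ is placed above $D$. For $\mu\in{}^PW$ let $e_\mu=e_{i_1}\cdots e_{i_k}$, where $s_{i_1}\cdots s_{i_k}$ is a reduced expression for $\mu$. Let $\mathbb{DT}[C_n]$ be the set of tangles without closed loops that satisfy one of the following: (1) the first northern and first southern vertices are joined by an undecorated strand; (2) they are joined by a decorated strand, and there is at least one northern and one southern arc; (3) the strands at the first northern and first southern vertices are distinct and both decorated. *Orientations.* The coset diagram of $\lambda\in{}^PW$ is a row of $n+1$ symbols: the first is $\circ$, and for $2\le i\le n+1$ the $i$-th is $\wedge$ if $\lambda(i)<0$ and $\vee$ if $\lambda(i)>0$. Put the coset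 diagram of $\varnothing$ on the southern and that of $\lambda$ on the northern boundary of $e_\mu$; the result is denoted $\varnothing e_\mu\lambda$. A strand joining two arrows is *oriented* if exactly one of its two arrows points into it, and *flip-oriented* if both or neither do. A strand joining $\circ$ to an arrow is both oriented and flip-oriented. We write $\varnothing e_\mu\lambda\in\mathbb{ODT}[C_n,A_{n-1}]$ if $e_\mu\in\mathbb{DT}[C_n]$, every undecorated strand is oriented (an undecorated strand joining $\circ$ to $\circ$ is allowed), and no strand joining $\circ$ to $\circ$ is decorated. Such a diagram is *standard* if every decorated strand is flip-oriented. Its degree is the number of northern arcs whose right end is labelled $\vee$ minus the number of southern arcs whose right end is labelled $\wedge$. Define matrices indexed by ${}^PW$ by $$N_{\lambda,\mu}=\begin{cases}q^{\deg(\varnothing e_\mu\lambda)}&\text{if }\varnothing e_\mu\lambda\in\mathbb{ODT}[C_n,A_{n-1}]\text{ is standard},\\0&\text{otherwise,}\end{cases}\qquad B_{\lambda,\mu}=\begin{cases}1&\text{if }\varnothing e_\mu\lambda\in\mathbb{ODT}[C_n,A_{n-1}]\text{ and }\deg(\varnothing e_\mu\lambda)=0,\\0&\text{otherwise.}\end{cases}$$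 **Theorem.** For every choice of the paths $T^\mu$ and of the reduced expressions defining $e_\mu$, the light leaves matrix factorises as $\Delta=N\,B$. -/

import Mathlib

open scoped LaurentPolynomial

namespace TypeC

/-! ### The Coxeter group of type `C_n` as the group of signed permutations

The letter `(ε, k) : ℤˣ × Fin n` stands for the signed integer `ε * (k + 2)`, so that the letters
are `±2, …, ±(n + 1)`.  The simple reflections are indexed by `Fin n`: the index `0` stands for
`s_{1'}` and the index `j ≥ 1` stands for `s_{j + 1}`. -/

/-- The sign change `x ↦ -x` on the letters. -/
def signFlip (n : ℕ) : Equiv.Perm (ℤˣ × Fin n) :=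
  Equiv.prodCongr (Equiv.neg ℤˣ) (Equiv.refl (Fin n))

/-- The Coxeter group of type `C_n`: all permutations `w` of `±2, …, ±(n + 1)` such that
`w (-x) = -(w x)`. -/
abbrev Grp (n : ℕ) : Type :=
  ↥(Subgroup.centralizer ({signFlip n} : Set (Equiv.Perm (ℤˣ × Fin n))))

/-- The underlying permutation of a simple reflection: the index `0` changes the sign of the
letter `±2`, and the index `j ≥ 1` exchanges the letters `±(j + 1)` and `±(j + 2)`. -/
def simplePerm (n : ℕ) (j : Fin n) : Equiv.Perm (ℤˣ × Fin n) :=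
  if j.val = 0 then
    { toFun := fun x => (if x.2 = j then -x.1 else x.1, x.2)
      invFun := fun x => (if x.2 = j then -x.1 else x.1, x.2)
      left_inv := by
        rintro ⟨a, b⟩
        by_cases h : b = j <;> simp [h]
      right_inv := by
        rintro ⟨a, b⟩
        by_cases h : b = j <;> simp [h] }
  else
    Equiv.prodCongr (Equiv.refl ℤˣ)
      (Equiv.swap (⟨j.val - 1, lt_of_le_of_lt (Nat.sub_le _ _) j.isLt⟩ : Fin n) j)

theorem simplePerm_mem (n : ℕ) (j : Fin n) :
    simplePerm n j ∈ Subgroup.centralizer ({signFlip n} : Set (Equiv.Perm (ℤˣ × Fin n))) := by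
  rw [Subgroup.mem_centralizer_singleton_iff]
  ext1 ⟨a, b⟩
  by_cases h0 : j.val = 0
  · by_cases h : b = j <;> simp [simplePerm, signFlip, h0, h]
  · simp [simplePerm, signFlip, h0]

/-- The simple reflections of the Coxeter group of type `C_n`. -/
def simple {n : ℕ} (j : Fin n) : Grp n :=
  ⟨simplePerm n j, simplePerm_mem n j⟩

/-- The product of an expression in the simple reflections. -/
def wordProd {n : ℕ} (u : List (Fin n)) : Grp n :=
  (u.map simple).prod

/-- The Coxeter length. -/
noncomputable def length {n : ℕ} (w : Grp n) : ℕ :=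
  sInf {k : ℕ | ∃ u : List (Fin n), u.length = k ∧ wordProd u = w}

/-- The expression `u` is a reduced expression for `w`. -/
def IsReducedExpr {n : ℕ} (u : List (Fin n)) (w : Grp n) : Prop :=
  wordProd u = w ∧ u.length = length w

/-- The strong Bruhat order: some reduced expression of `w` contains a reduced expression of `y`
as a subsequence. -/
def BruhatLE {n : ℕ} (y w : Grp n) : Prop :=
  ∃ u v : List (Fin n), IsReducedExpr u w ∧ IsReducedExpr v y ∧ v.Sublist u

/-- The strict Bruhat order. -/
def BruhatLT {n : ℕ} (y w : Grp n) : Prop :=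
  BruhatLE y w ∧ y ≠ w

/-- The parabolic subgroup `P` of type `A_{n-1}`, generated by all simple reflections except
`s_{1'}`. -/
def parabolic (n : ℕ) : Subgroup (Grp n) :=
  Subgroup.closure {g : Grp n | ∃ j : Fin n, j.val ≠ 0 ∧ g = simple j}

/-- The set `^P W` of minimal length representatives of the cosets `P w` in `P \ W`. -/
abbrev Coset (n : ℕ) : Type :=
  {w : Grp n // ∀ p ∈ parabolic n, length w ≤ length (p * w)}

noncomputable instance instFintypeCoset (n : ℕ) : Fintype (Coset n) :=
  Fintype.ofFinite _

theorem length_one (n : ℕ) : length (1 : Grp n) = 0 :=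
  Nat.sInf_eq_zero.mpr (Or.inl ⟨[], rfl, rfl⟩)

/-- The minimal representative `∅` of the identity coset. -/
def emptyCoset (n : ℕ) : Coset n :=
  ⟨1, fun p _ => by rw [length_one]; exact Nat.zero_le _⟩

/-! ### Paths on the extended Bruhat graph and the light leaves matrix -/

/-- The edges `lam → lam'` with label `i` of the extended Bruhat graph: the element `mu = lam s_i`
lies in `^P W` and is joined to `lam` in the Bruhat graph, and `lam'` is `lam` or `mu`. -/
def IsEdge {n : ℕ} (lam : Coset n) (i : Fin n) (lam' : Coset n) : Prop :=
  ∃ mu : Coset n, mu.1 = lam.1 * simple i ∧ (BruhatLT lam.1 mu.1 ∨ BruhatLT mu.1 lam.1) ∧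
    (lam' = lam ∨ lam' = mu)

open Classical in
/-- The degree of an edge of the extended Bruhat graph: `0` for `lam → lam s_i`; and for
`lam → lam` it is `1` if `lam < lam s_i` and `-1` if `lam s_i < lam`. -/
noncomputable def edgeDeg {n : ℕ} (lam : Coset n) (i : Fin n) (lam' : Coset n) : ℤ :=
  if lam'.1 = lam.1 * simple i then 0
  else if BruhatLT lam.1 (lam.1 * simple i) then 1 else -1

/-- Paths with `k` steps on the extended Bruhat graph which start at `∅`. -/
@[ext]
structure BruhatPath (n k : ℕ) where
  vertex : Fin (k + 1) → Coset n
  label : Fin k → Fin n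
  start : vertex 0 = emptyCoset n
  edge : ∀ j : Fin k, IsEdge (vertex j.castSucc) (label j) (vertex j.succ)

namespace BruhatPath

/-- The end point of a path. -/
def shape {n k : ℕ} (S : BruhatPath n k) : Coset n :=
  S.vertex (Fin.last k)

/-- The degree of a path is the sum of the degrees of its edges. -/
noncomputable def deg {n k : ℕ} (S : BruhatPath n k) : ℤ :=
  ∑ j : Fin k, edgeDeg (S.vertex j.castSucc) (S.label j) (S.vertex j.succ)

/-- A path is reduced if no path from `∅` to the same end point has fewer steps. -/
def IsReduced {n k : ℕ} (S : BruhatPath n k) : Prop :=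
  ∀ (k' : ℕ) (S' : BruhatPath n k'), S'.shape = S.shape → k ≤ k'

end BruhatPath

/-- A choice of a reduced path from `∅` to `mu` for each `mu` in `^P W`. -/
structure ReducedPaths (n : ℕ) where
  len : Coset n → ℕ
  path : (mu : Coset n) → BruhatPath n (len mu)
  shape_eq : ∀ mu : Coset n, (path mu).shape = mu
  reduced : ∀ mu : Coset n, (path mu).IsReduced

/-- The set of all paths from `∅` to `lam` with the same sequence of edge labels as `S`. -/
abbrev PathsTo {n k : ℕ} (lam : Coset n) (S : BruhatPath n k) : Type :=
  {S' : BruhatPath n k // S'.shape = lam ∧ S'.label = S.label}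

instance instFiniteBruhatPath (n k : ℕ) : Finite (BruhatPath n k) :=
  Finite.of_injective (fun S : BruhatPath n k => (S.vertex, S.label)) (by
    intro S S' h
    exact BruhatPath.ext (congrArg Prod.fst h) (congrArg Prod.snd h))

noncomputable instance instFintypePathsTo {n k : ℕ} (lam : Coset n) (S : BruhatPath n k) :
    Fintype (PathsTo lam S) :=
  Fintype.ofFinite _

/-- The matrix of light leaves polynomials. -/
noncomputable def lightLeaves {n : ℕ} (R : ReducedPaths n) :
    Matrix (Coset n) (Coset n) ℤ[T;T⁻¹] :=
  Matrix.of fun lam mu => ∑ S : PathsTo lam (R.path mu), LaurentPolynomial.T S.1.deg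

/-! ### Decorated tangles

The vertices on the northern and on the southern boundary of the frame are numbered
`0, …, m - 1` from left to right. -/

/-- The boundary vertices of an `m`-tangle. -/
inductive Vertex (m : ℕ) where
  | north (k : Fin m)
  | south (k : Fin m)
  deriving DecidableEq

/-- The position of a vertex when one walks along the boundary of the frame, first along the
northern boundary from left to right, then along the southern boundary from right to left. -/
def Vertex.pos {m : ℕ} : Vertex m → ℕ
  | .north k => k.val
  | .south k => 2 * m - 1 - k.val

theorem Vertex.pos_injective (m : ℕ) : Function.Injective (Vertex.pos (m := m)) := by
  rintro (⟨a, ha⟩ | ⟨a, ha⟩) (⟨b, hb⟩ | ⟨b, hb⟩) h <;> simp [Vertex.pos] at h ⊢ <;> omega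

/-- Decorated `m`-tangles up to isotopy, where several beads on one strand are identified with a
single bead, and the closed loops are merely counted.  The strands are given by the fixed-point free
involution `partner` of the boundary vertices.  As the left side of the frame lies between the last
and the first boundary vertex, a strand can be deformed to touch it if and only if no
other strand encloses it in the boundary order; only such strands may carry a bead. -/
structure Tangle (m : ℕ) where
  partner : Vertex m → Vertex m
  bead : Vertex m → Bool
  loops : ℕ
  partner_ne : ∀ x, partner x ≠ x
  partner_partner : ∀ x, partner (partner x) = x
  bead_partner : ∀ x, bead (partner x) = bead x
  noncrossing : ∀ x y, ¬ (x.pos < y.pos ∧ y.pos < (partner x).pos ∧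
    (partner x).pos < (partner y).pos)
  leftExposed : ∀ x, bead x = true → ∀ y, ¬ (y.pos < x.pos ∧ y.pos < (partner x).pos ∧
    x.pos < (partner y).pos ∧ (partner x).pos < (partner y).pos)

namespace Tangle

theorem between_iff {m : ℕ} (d : Tangle m) (x y : Vertex m) (h1 : y ≠ x) (h2 : y ≠ d.partner x) :
    ((x.pos < y.pos ∧ y.pos < (d.partner x).pos) ∨ ((d.partner x).pos < y.pos ∧ y.pos < x.pos)) ↔
    ((x.pos < (d.partner y).pos ∧ (d.partner y).pos < (d.partner x).pos) ∨
      ((d.partner x).pos < (d.partner y).pos ∧ (d.partner y).pos < x.pos)) := by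
  have hinj := Vertex.pos_injective m
  have e1 : y.pos ≠ x.pos := fun h => h1 (hinj h)
  have e2 : y.pos ≠ (d.partner x).pos := fun h => h2 (hinj h)
  have e3 : (d.partner y).pos ≠ x.pos := fun h => h2 (by
    rw [← hinj h, d.partner_partner])
  have e4 : (d.partner y).pos ≠ (d.partner x).pos := fun h => h1 (by
    rw [← d.partner_partner y, hinj h, d.partner_partner])
  have n1 := d.noncrossing x y
  have n2 := d.noncrossing x (d.partner y)
  have n3 := d.noncrossing (d.partner x) y
  have n4 := d.noncrossing (d.partner x) (d.partner y)
  have n5 := d.noncrossing y x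
  have n6 := d.noncrossing y (d.partner x)
  have n7 := d.noncrossing (d.partner y) x
  have n8 := d.noncrossing (d.partner y) (d.partner x)
  simp only [d.partner_partner] at n1 n2 n3 n4 n5 n6 n7 n8
  omega

/-- The identity tangle, with undecorated vertical strands only. -/
def one (m : ℕ) : Tangle m where
  partner
    | .north k => .south k
    | .south k => .north k
  bead _ := false
  loops := 0
  partner_ne := by rintro (k | k) <;> simp
  partner_partner := by rintro (k | k) <;> rfl
  bead_partner _ := rfl
  noncrossing := by
    rintro (⟨a, ha⟩ | ⟨a, ha⟩) (⟨b, hb⟩ | ⟨b, hb⟩) <;> simp only [Vertex.pos] <;> omega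
  leftExposed := by simp

section stack

variable {m : ℕ} (d : Tangle m) (a b : Fin m) (c : Bool)

/-- The strands of the tangle obtained by placing the cup-cap generator at the neighbouring
vertices `a, b` on top of `d`: there is a new northern arc from `a` to `b`, and the southern arc of
the generator joins the strands of `d` which start at the northern vertices `a` and `b`. -/
def stackPartner (x : Vertex m) : Vertex m :=
  if x = .north a then .north b
  else if x = .north b then .north a
  else if d.partner x = .north a then d.partner (.north b)
  else if d.partner x = .north b then d.partner (.north a)
  else d.partner x

/-- The beads of the same tangle, where both arcs of the generator carry a bead if `c` is true. -/
def stackBead (x : Vertex m) : Bool :=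
  if x = .north a ∨ x = .north b then c
  else if d.partner x = .north a ∨ d.partner x = .north b then
    d.bead (.north a) || d.bead (.north b) || c
  else d.bead x

theorem stackPartner_cases (hab : a.val + 1 = b.val) (x : Vertex m) :
    (x = .north a ∧ d.stackPartner a b x = .north b ∧ d.stackBead a b c x = c) ∨
    (x = .north b ∧ d.stackPartner a b x = .north a ∧ d.stackBead a b c x = c) ∨
    (x ≠ .north a ∧ x ≠ .north b ∧ d.partner (.north a) = x ∧ d.partner (.north a) ≠ .north b ∧
      d.stackPartner a b x = d.partner (.north b) ∧
      d.stackBead a b c x = (d.bead (.north a) || d.bead (.north b) || c)) ∨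
    (x ≠ .north a ∧ x ≠ .north b ∧ d.partner (.north b) = x ∧ d.partner (.north a) ≠ .north b ∧
      d.stackPartner a b x = d.partner (.north a) ∧
      d.stackBead a b c x = (d.bead (.north a) || d.bead (.north b) || c)) ∨
    (x ≠ .north a ∧ x ≠ .north b ∧ d.partner x ≠ .north a ∧ d.partner x ≠ .north b ∧
      d.stackPartner a b x = d.partner x ∧ d.stackBead a b c x = d.bead x) := by
  have hne : (Vertex.north b : Vertex m) ≠ .north a := by
    intro h
    injection h with h
    rw [h] at hab
    omega
  by_cases h1 : x = .north a
  · left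
    subst h1
    simp [stackPartner, stackBead]
  by_cases h2 : x = .north b
  · right; left
    subst h2
    simp [stackPartner, stackBead, hne]
  by_cases h3 : d.partner x = .north a
  · right; right; left
    have h3' : d.partner (.north a) = x := by rw [← h3, d.partner_partner]
    refine ⟨h1, h2, h3', by rw [h3']; exact h2, ?_, ?_⟩ <;>
      simp [stackPartner, stackBead, h1, h2, h3]
  by_cases h4 : d.partner x = .north b
  · right; right; right; left
    have h4' : d.partner (.north b) = x := by rw [← h4, d.partner_partner]
    refine ⟨h1, h2, h4', ?_, ?_, ?_⟩
    · intro h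
      apply h1
      rw [← h4', ← h, d.partner_partner]
    all_goals simp [stackPartner, stackBead, h1, h2, h4, hne]
  · right; right; right; right
    refine ⟨h1, h2, h3, h4, ?_, ?_⟩ <;> simp [stackPartner, stackBead, h1, h2, h3, h4]

/-- The tangle obtained by placing a cup-cap generator at the neighbouring vertices `a, b` on top
of `d`.  Both arcs of the generator carry a bead if `c` is true.  A closed loop arises if `d` has a
northern arc from `a` to `b`. -/
def stack (hab : a.val + 1 = b.val) (hc : c = true → a.val = 0) : Tangle m where
  partner := d.stackPartner a b
  bead := d.stackBead a b c
  loops := if d.partner (.north a) = .north b then d.loops + 1 else d.loops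
  partner_ne := by
    intro x
    have hne : (Vertex.north b : Vertex m) ≠ .north a := by
      intro h
      injection h with h
      rw [h] at hab
      omega
    rcases d.stackPartner_cases a b c hab x with h | h | h | h | h
    · rw [h.2.1, h.1]; exact hne
    · rw [h.2.1, h.1]; exact hne.symm
    · rw [h.2.2.2.2.1, ← h.2.2.1]
      intro e
      apply hne
      rw [← d.partner_partner (.north b), e, d.partner_partner]
    · rw [h.2.2.2.2.1, ← h.2.2.1]
      intro e
      apply hne
      rw [← d.partner_partner (.north b), ← e, d.partner_partner]
    · rw [h.2.2.2.2.1]; exact d.partner_ne x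
  partner_partner := by
    intro x
    have p1 := d.partner_partner x
    have p2 := d.partner_partner (.north a)
    have p3 := d.partner_partner (.north b)
    have q1 := d.partner_ne (.north a)
    have q2 := d.partner_ne (.north b)
    have c1 := d.stackPartner_cases a b c hab x
    have c2 := d.stackPartner_cases a b c hab (d.stackPartner a b x)
    grind
  bead_partner := by
    intro x
    have p1 := d.partner_partner x
    have p2 := d.partner_partner (.north a)
    have p3 := d.partner_partner (.north b)
    have q1 := d.partner_ne (.north a)
    have q2 := d.partner_ne (.north b)
    have b1 := d.bead_partner x
    have c1 := d.stackPartner_cases a b c hab x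
    have c2 := d.stackPartner_cases a b c hab (d.stackPartner a b x)
    grind
  noncrossing := by
    intro x y
    have pa : (Vertex.north a).pos = a.val := rfl
    have pb : (Vertex.north b).pos = b.val := rfl
    have inj : ∀ u v : Vertex m, u ≠ v → u.pos ≠ v.pos := fun u v h e => h (Vertex.pos_injective m e)
    have pp := d.partner_partner
    rcases d.stackPartner_cases a b c hab x with ⟨hx, ex, -⟩ | ⟨hx, ex, -⟩ |
      ⟨hx1, hx2, hx, hx0, ex, -⟩ | ⟨hx1, hx2, hx, hx0, ex, -⟩ | ⟨hx1, hx2, hx3, hx4, ex, -⟩ <;>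
    rcases d.stackPartner_cases a b c hab y with ⟨hy, ey, -⟩ | ⟨hy, ey, -⟩ |
      ⟨hy1, hy2, hy, hy0, ey, -⟩ | ⟨hy1, hy2, hy, hy0, ey, -⟩ | ⟨hy1, hy2, hy3, hy4, ey, -⟩ <;>
    rw [ex, ey]
    all_goals first
      | (clear ex ey; subst hx; omega)
      | (clear ex ey; subst hy; omega)
      | exact d.noncrossing x y
      | skip
    all_goals first
      | (have k1 := d.between_iff (.north a) y hy1 (fun e => hy3 (by rw [e, pp]))
         have k2 := d.between_iff (.north b) y hy2 (fun e => hy4 (by rw [e, pp]))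
         have i1 := inj _ _ hy1
         have i2 := inj _ _ hy2
         have i3 := inj _ _ hy3
         have i4 := inj _ _ hy4
         rw [hx] at *
         omega)
      | (have k1 := d.between_iff (.north a) x hx1 (fun e => hx3 (by rw [e, pp]))
         have k2 := d.between_iff (.north b) x hx2 (fun e => hx4 (by rw [e, pp]))
         have i1 := inj _ _ hx1
         have i2 := inj _ _ hx2
         have i3 := inj _ _ hx3
         have i4 := inj _ _ hx4
         rw [hy] at *
         omega)
  leftExposed := by
    intro x hb y
    have pa : (Vertex.north a).pos = a.val := rfl
    have pb : (Vertex.north b).pos = b.val := rfl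
    have inj : ∀ u v : Vertex m, u ≠ v → u.pos ≠ v.pos := fun u v h e => h (Vertex.pos_injective m e)
    have pp := d.partner_partner
    rcases d.stackPartner_cases a b c hab x with ⟨hx, ex, bx⟩ | ⟨hx, ex, bx⟩ |
      ⟨hx1, hx2, hx, hx0, ex, bx⟩ | ⟨hx1, hx2, hx, hx0, ex, bx⟩ | ⟨hx1, hx2, hx3, hx4, ex, bx⟩ <;>
    rcases d.stackPartner_cases a b c hab y with ⟨hy, ey, -⟩ | ⟨hy, ey, -⟩ |
      ⟨hy1, hy2, hy, hy0, ey, -⟩ | ⟨hy1, hy2, hy, hy0, ey, -⟩ | ⟨hy1, hy2, hy3, hy4, ey, -⟩ <;>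
    rw [ex, ey] <;> rw [bx] at hb
    all_goals first
      | (have h0 := hc hb; clear ex ey; subst hx; omega)
      | (clear ex ey; subst hy; omega)
      | exact d.leftExposed x hb y
      | skip
    all_goals try simp only [Bool.or_eq_true] at hb
    all_goals first
      | omega
      | (have k1 := d.between_iff y (.north a) hy1.symm hy3.symm
         have k2 := d.between_iff y (.north b) hy2.symm hy4.symm
         have i1 := inj _ _ hy1
         have i2 := inj _ _ hy2
         have i3 := inj _ _ hy3
         have i4 := inj _ _ hy4
         try rw [hx] at k1
         try rw [hx] at k2
         try rw [hx]
         rcases hb with (hb | hb) | hb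
         · have l1 := d.leftExposed _ hb y
           try rw [hx] at l1
           omega
         · have l1 := d.leftExposed _ hb y
           try rw [hx] at l1
           omega
         · have h0 := hc hb
           omega)
      | (have k1 := d.between_iff x (.north a) hx1.symm hx3.symm
         have k2 := d.between_iff x (.north b) hx2.symm hx4.symm
         have i1 := inj _ _ hx1
         have i2 := inj _ _ hx2
         have i3 := inj _ _ hx3
         have i4 := inj _ _ hx4
         have l1 := d.leftExposed x hb (.north a)
         have l2 := d.leftExposed x hb (.north b)
         have l3 := d.leftExposed x hb (d.partner (.north a))
         have l4 := d.leftExposed x hb (d.partner (.north b))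
         rw [pp] at l3 l4
         rw [hy] at *
         omega)

end stack

end Tangle

/-- Placing the `j`-th generator of the Temperley--Lieb algebra of type `C_n` on top of `d`.  Counting
the `n + 1` vertices from `0`, it has its arcs at the vertices `j` and `j + 1`, and these carry a bead
if and only if `j = 0`. -/
def topMul {n : ℕ} (d : Tangle (n + 1)) (j : Fin n) : Tangle (n + 1) :=
  d.stack j.castSucc j.succ (decide (j.val = 0)) (by simp) (by simp)

/-- The product `e_{i_1} e_{i_2} ⋯ e_{i_k}` of generators, where `D D'` is obtained by placing `D'`
above `D`. -/
def tlProd {n : ℕ} (u : List (Fin n)) : Tangle (n + 1) :=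
  u.foldl topMul (Tangle.one (n + 1))

/-- The diagram basis of the Temperley--Lieb algebra of type `C_n`. -/
def InDTC {n : ℕ} (d : Tangle (n + 1)) : Prop :=
  d.loops = 0 ∧
  ((d.partner (.north 0) = .south 0 ∧ d.bead (.north 0) = false) ∨
   (d.partner (.north 0) = .south 0 ∧ d.bead (.north 0) = true ∧
      (∃ i j : Fin (n + 1), d.partner (.north i) = .north j) ∧
      (∃ i j : Fin (n + 1), d.partner (.south i) = .south j)) ∨
   (d.partner (.north 0) ≠ .south 0 ∧ d.bead (.north 0) = true ∧ d.bead (.south 0) = true))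

/-! ### Oriented tangles -/

/-- The symbols `∧`, `∨`, `∘` of a coset diagram. -/
inductive Arrow where
  | up
  | down
  | circ
  deriving DecidableEq

/-- The coset diagram of `lam`, on the positions `0, …, n`.  The symbol at position `0` is `∘`.  The
symbol at position `k + 1` is `∧` if `lam` sends the positive letter `k + 2` to a negative letter, and
`∨` otherwise.  So the identity coset is `∘∨∨⋯∨`, right multiplication by `s_{1'}` flips the symbol at
position `1`, and right multiplication by another simple reflection swaps two neighbouring symbols. -/
def diagram {n : ℕ} (lam : Coset n) : Fin (n + 1) → Arrow :=
  Fin.cases .circ fun k => if (lam.1.1 (1, k)).1 = -1 then .up else .down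

/-- The symbol at a boundary vertex if the symbols `s` are placed on the southern boundary and the
symbols `t` on the northern boundary. -/
def symbolAt {m : ℕ} (s t : Fin m → Arrow) : Vertex m → Arrow
  | .north k => t k
  | .south k => s k

/-- The arrow at the vertex `x` points into the strand at `x`. -/
def PointsIn {m : ℕ} (s t : Fin m → Arrow) : Vertex m → Prop
  | .north k => t k = .down
  | .south k => s k = .up

/-- The strand at `x` ends at a symbol `∘`. -/
def TouchesCirc {m : ℕ} (d : Tangle m) (s t : Fin m → Arrow) (x : Vertex m) : Prop :=
  symbolAt s t x = .circ ∨ symbolAt s t (d.partner x) = .circ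

/-- The strand at `x` is oriented: one arrow points into the strand and the other one points out of
it, or one of its ends is `∘`. -/
def StrandOriented {m : ℕ} (d : Tangle m) (s t : Fin m → Arrow) (x : Vertex m) : Prop :=
  TouchesCirc d s t x ∨ (PointsIn s t x ↔ ¬ PointsIn s t (d.partner x))

/-- The strand at `x` is flip-oriented: both arrows point into the strand or both point out of it,
or one of its ends is `∘`. -/
def StrandFlipOriented {m : ℕ} (d : Tangle m) (s t : Fin m → Arrow) (x : Vertex m) : Prop :=
  TouchesCirc d s t x ∨ (PointsIn s t x ↔ PointsIn s t (d.partner x))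

/-- `lam d mu`, with `lam` on the southern and `mu` on the northern boundary of `d`, is an oriented
tangle of type `(C_n, A_{n-1})`: `d` belongs to the diagram basis, every undecorated strand is
oriented, and a strand which joins `∘` to `∘` has no decoration. -/
def InODT {n : ℕ} (lam : Coset n) (d : Tangle (n + 1)) (mu : Coset n) : Prop :=
  InDTC d ∧
  (∀ x, d.bead x = false → StrandOriented d (diagram lam) (diagram mu) x) ∧
  (∀ x, symbolAt (diagram lam) (diagram mu) x = .circ →
    symbolAt (diagram lam) (diagram mu) (d.partner x) = .circ → d.bead x = false)

/-- Every decorated strand of `lam d mu` is flip-oriented. -/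
def IsStandard {n : ℕ} (lam : Coset n) (d : Tangle (n + 1)) (mu : Coset n) : Prop :=
  ∀ x, d.bead x = true → StrandFlipOriented d (diagram lam) (diagram mu) x

/-- The degree of `lam d mu`: the number of northern arcs whose rightmost vertex is labelled by `∨`
minus the number of southern arcs whose rightmost vertex is labelled by `∧`. -/
def tangleDeg {n : ℕ} (lam : Coset n) (d : Tangle (n + 1)) (mu : Coset n) : ℤ :=
  ((Finset.univ.filter fun p : Fin (n + 1) × Fin (n + 1) =>
      p.1 < p.2 ∧ d.partner (.north p.1) = .north p.2 ∧ diagram mu p.2 = .down).card : ℤ) -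
  ((Finset.univ.filter fun p : Fin (n + 1) × Fin (n + 1) =>
      p.1 < p.2 ∧ d.partner (.south p.1) = .south p.2 ∧ diagram lam p.2 = .up).card : ℤ)

/-! ### The matrices `N` and `B`

Here `r mu` is a reduced expression for `mu`, so that `tlProd (r mu)` is the diagram `e_mu`. -/

open Classical in
/-- The matrix with entries `q ^ deg (∅ e_mu lam)` if `∅ e_mu lam` is a standard oriented tangle, and
`0` otherwise. -/
noncomputable def matrixN {n : ℕ} (r : Coset n → List (Fin n)) :
    Matrix (Coset n) (Coset n) ℤ[T;T⁻¹] :=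
  Matrix.of fun lam mu =>
    if InODT (emptyCoset n) (tlProd (r mu)) lam ∧ IsStandard (emptyCoset n) (tlProd (r mu)) lam then
      LaurentPolynomial.T (tangleDeg (emptyCoset n) (tlProd (r mu)) lam)
    else 0

open Classical in
/-- The matrix with entries `1` if `∅ e_mu lam` is an oriented tangle of degree `0`, and `0`
otherwise. -/
noncomputable def matrixB {n : ℕ} (r : Coset n → List (Fin n)) :
    Matrix (Coset n) (Coset n) ℤ[T;T⁻¹] :=
  Matrix.of fun lam mu =>
    if InODT (emptyCoset n) (tlProd (r mu)) lam ∧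
        tangleDeg (emptyCoset n) (tlProd (r mu)) lam = 0 then 1
    else 0

end TypeC

namespace TypeC

/-! The southern boundary of `∅ e_μ λ` carries only `∘∨⋯∨`, so its orientations and its degree are
visible in the northern half of `e_μ`, a cap diagram with beads. Cosets are encoded by sign vectors.
The symbol `∘` is treated as a permanent `∧` at position 0, and position 0 always counts as beaded.
Every simple reflection, `s_{1'}` included, then raises a coset exactly when it acts on neighbouring
signs `∧∨`.

The first half of the argument shows that each entry of `Δ` is zero or a single monomial: it is `q ^
deg` if `λ` orients all undecorated strands of `e_μ`, and `0` otherwise. Splitting off the last step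
of a path expresses the new sum at `λ` as the old sum at `λ s_i` plus `q ^ (±1)` times the old sum
at `λ`. Stacking `e_i` on a cap diagram gives the same recursion (`capWeight_stack`): the unbeaded
strand at the right-hand vertex prescribes the sign there, so one of the two terms always vanishes.
The labels of a shortest path form a reduced expression (`ReducedPaths.label_ascending`), so the
induction applies to `T^μ`.

The second half rests on bracket matching: a cap diagram with its beads can be recovered from its
sign vector (`IsCap.eq_of_hasShape`). This gives independence of all choices. It also shows that if
`ν` orients `e_μ` in degree zero, then the northern half of `e_ν` has the arcs of that of `e_μ`,
with beads kept only on strands whose ends are all `∧` in `ν`. Hence an orientation `λ` of `e_μ`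
factors through exactly one `ν`, namely `middleSign`: a beaded strand keeps its bead if `λ`
flip-orients it and loses it otherwise, while the strand at position 0 always keeps it. Only this
`ν` contributes to the entry of `N B`, and since the arcs agree, it contributes the right power of
`q`. -/

/-! ### Cap diagrams

The northern half of a tangle: `p x` is the northern vertex joined to `x`, or `x` itself if the
strand at `x` ends on the southern boundary, and `b` marks the strands with a bead. -/

/-- The conditions on the northern half of a decorated tangle. -/
structure IsCap {m : ℕ} (p : Fin m → Fin m) (b : Fin m → Bool) : Prop where
  invol : ∀ x, p (p x) = x
  bead : ∀ x, b (p x) = b x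
  noncrossing : ∀ x y, x < y → y < p x → x < p y ∧ p y < p x
  through : ∀ x y, x < y → y < p x → p y ≠ y
  exposed : ∀ x y, x < y → y < p x → b y = false
  left : ∀ x y, p x = x → b y = true → y ≤ x

/-- The sign vector `s` (with `true` for `∧` and `∘`) has `p, b` as its cap diagram. -/
def HasShape {m : ℕ} (p : Fin m → Fin m) (b : Fin m → Bool) (s : Fin m → Bool) : Prop :=
  ∀ x, s x = (b x || decide (p x < x))

/-- Every undecorated strand is oriented by the signs `s`. -/
def CapOriented {m : ℕ} (p : Fin m → Fin m) (b : Fin m → Bool) (s : Fin m → Bool) : Prop :=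
  ∀ x, b x = false → (p x = x → s x = false) ∧ (p x ≠ x → s x ≠ s (p x))

/-- The number of arcs whose right end is labelled `∨`. -/
def capDeg {m : ℕ} (p : Fin m → Fin m) (s : Fin m → Bool) : ℤ :=
  ∑ y, if p y < y ∧ s y = false then 1 else 0

/-- The arcs after a cup-cap generator has been stacked at `a` and `b`. -/
def capPartner {m : ℕ} (p : Fin m → Fin m) (a b x : Fin m) : Fin m :=
  if x = a then b
  else if x = b then a
  else if p x = a then (if p b = b then x else p b)
  else if p x = b then (if p a = a then x else p a)
  else p x

/-- The beads after a cup-cap generator has been stacked at `a` and `b`. -/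
def capBead {m : ℕ} (p : Fin m → Fin m) (d : Fin m → Bool) (a b : Fin m) (c : Bool)
    (x : Fin m) : Bool :=
  if x = a ∨ x = b then c
  else if p x = a ∨ p x = b then d a || d b || c
  else d x

/-! ### Stacking a cup-cap generator on a cap diagram. -/

section stack

variable {m : ℕ} {p : Fin m → Fin m} {d : Fin m → Bool} {a b : Fin m} {c : Bool}

/-- A `∨` at `b` can only be the left end of an unbeaded arc or an unbeaded through strand, whereas
an `∧` at `a` is beaded or a right end. Hence `a` and `b` are not joined, and stacking at a raising
step creates no loop. -/
theorem HasShape.step_facts {s : Fin m → Bool} (h : IsCap p d) (hs : HasShape p d s)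
    (hab : a.val + 1 = b.val) (ha : s a = true) (hb : s b = false) :
    d b = false ∧ b ≤ p b ∧ (d a = true ∨ p a < a) ∧ p a ≠ b := by
  have h1 := hs a
  have h2 := hs b
  have h3 := h.bead a
  have hlt : a < b := by rw [Fin.lt_def]; omega
  rw [ha] at h1
  rw [hb] at h2
  simp only [Bool.false_eq, Bool.or_eq_false_iff, decide_eq_false_iff_not, not_lt] at h2
  simp only [Bool.true_eq, Bool.or_eq_true, decide_eq_true_eq] at h1
  refine ⟨h2.1, h2.2, h1, ?_⟩
  intro e
  rw [e] at h1 h3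
  rcases h1 with h1 | h1
  · rw [h1, h2.1] at h3; exact absurd h3 (by simp)
  · exact absurd h1 (not_lt.mpr hlt.le)

/-- The joined strand inherits the bead of the strand at `a`. If there is none, its left end is `p a
< a`, so the far ends of the old strands keep their signs. -/
theorem HasShape.stack {s s' : Fin m → Bool} (h : IsCap p d) (hs : HasShape p d s)
    (hab : a.val + 1 = b.val) (ha : s a = true) (hb : s b = false)
    (h' : ∀ x, x ≠ a → x ≠ b → s' x = s x) (hb' : s' b = true) (ha' : s' a = c)
    (hc : c = false → d a = true ∨ p a < a) (hc' : c = true → d a = true) :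
    HasShape (capPartner p a b) (capBead p d a b c) s' := by
  obtain ⟨f1, f2, f3, f4⟩ := hs.step_facts h hab ha hb
  have hlt : a < b := by rw [Fin.lt_def]; omega
  intro x
  have i1 := h.invol x
  have i2 := h.invol a
  have i3 := h.invol b
  have b1 := h.bead x
  by_cases hxa : x = a
  · subst hxa
    simp [capPartner, capBead, ha', hlt.not_gt]
  by_cases hxb : x = b
  · subst hxb
    simp [capPartner, capBead, hb', hlt, hxa]
  rw [h' x hxa hxb, hs x]
  by_cases hpa : p x = a
  · have e : p a = x := by rw [← hpa, i1]
    have b2 : d x = d a := by rw [← b1, hpa]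
    simp only [capPartner, capBead, hxa, hxb, hpa, if_true, if_false, true_or, or_self,
      f1, Bool.or_false]
    rw [b2]
    rw [e] at f3
    cases hda : d a <;> cases hcc : c <;> simp [hda, hcc] at *
    split_ifs <;> omega
  by_cases hpb : p x = b
  · have e : p b = x := by rw [← hpb, i1]
    have b2 : d x = d b := by rw [← b1, hpb]
    simp only [capPartner, capBead, hxa, hxb, hpb, if_true, if_false, or_true, or_self, f1, Bool.or_false]
    rw [b2, f1]
    rw [e] at f2
    have : b < x := lt_of_le_of_ne f2 (Ne.symm hxb)
    cases hda : d a <;> cases hcc : c <;> simp [hda, hcc] at * <;> try omega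
    split_ifs <;> omega
  simp [capPartner, capBead, hxa, hxb, hpa, hpb]

/-- The signs at `b` and `a` which are forced by the strand at `b`. -/
def forcedSign (p : Fin m → Fin m) (b : Fin m) (s : Fin m → Bool) : Bool :=
  if p b = b then true else s (p b)

/-- The strand at `b` is unbeaded, so an orientation must give `b` the sign opposite to
`forcedSign`. -/
theorem not_capOriented_of_forcedSign {s t : Fin m → Bool} (f1 : d b = false)
    (ha : p b ≠ a) (ht : ∀ x, x ≠ a → x ≠ b → t x = s x) (hb : t b = forcedSign p b s) :
    ¬ CapOriented p d t := by
  intro o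
  have := o b f1
  unfold forcedSign at hb
  by_cases e : p b = b
  · simp [e, hb] at this
  · have h1 := ht (p b) ha e
    simp [e, hb, h1] at this

/-- Pulling the joined strand through the zigzag at `a, b`: the far end of `b` fixes the sign at
`b`, the opposite sign is passed on to `a`, and this must suit the far end of `a`. If `a` is beaded,
so is the joined strand, and the sign at `a` does not matter. -/
theorem capOriented_stack_iff {s t : Fin m → Bool} (h : IsCap p d) (hab : a.val + 1 = b.val)
    (f1 : d b = false) (f2 : b ≤ p b) (f3 : d a = true ∨ p a < a) (f4 : p a ≠ b)
    (hc' : c = true → d a = true)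
    (ht : ∀ x, x ≠ a → x ≠ b → t x = s x) (hb : t b = !forcedSign p b s)
    (hta : d a = false → t a = forcedSign p b s) :
    CapOriented (capPartner p a b) (capBead p d a b c) s ↔
      (c = false → s a ≠ s b) ∧ CapOriented p d t := by
  have hlt : a < b := by rw [Fin.lt_def]; omega
  have i2 := h.invol a
  have i3 := h.invol b
  have hne : a ≠ b := hlt.ne
  have f5 : p b ≠ a := fun e => f4 (by rw [← e, i3])
  unfold CapOriented
  unfold forcedSign at hb hta
  constructor
  · intro o
    constructor
    · intro hc
      have := o a
      simp [capPartner, capBead, hc, hlt.ne'] at this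
      exact this
    · intro x hx
      have i1 := h.invol x
      have b1 := h.bead x
      have o1 := o x
      have o2 := o (p a)
      have o3 := o (p b)
      have ba := h.bead a
      have bb := h.bead b
      simp only [capPartner, capBead] at o1 o2 o3
      grind
  · rintro ⟨o0, o⟩ x hx
    have i1 := h.invol x
    have b1 := h.bead x
    have o1 := o x
    have o2 := o a
    have o3 := o b
    have ba := h.bead a
    have bb := h.bead b
    simp only [capPartner, capBead] at hx ⊢
    grind

/-- The new arc contributes the sign at `b`. Joining the old strands loses at most one right end:
`a` if `p a < a`, and otherwise `p b` if `b` lies on an arc. In the latter case an arc starting at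
`a` encloses that of `b` by planarity, so its right end survives. Whenever a right end is lost, its
sign is `forcedSign`. -/
theorem capDeg_stack {s t : Fin m → Bool} (h : IsCap p d) (hab : a.val + 1 = b.val)
    (f1 : d b = false) (f2 : b ≤ p b) (f3 : d a = true ∨ p a < a) (f4 : p a ≠ b)
    (ht : ∀ x, x ≠ a → x ≠ b → t x = s x) (hb : t b = !forcedSign p b s)
    (hta : p a < a → t a = forcedSign p b s) :
    capDeg (capPartner p a b) s = capDeg p t + (if s b = false then 1 else 0) -
      (if forcedSign p b s = false then 1 else 0) := by
  have hlt : a < b := by rw [Fin.lt_def]; omega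
  have i2 := h.invol a
  have i3 := h.invol b
  have hne : a ≠ b := hlt.ne
  have f5 : p b ≠ a := fun e => f4 (by rw [← e, i3])
  -- The contribution to the sum changes only at `a`, `b` and their far ends: `A` is lost at `a`,
  -- `B` is gained at `b`, and `C`, `D` are the changes at `p a` and `p b`.
  set A : ℤ := if p a < a ∧ t a = false then 1 else 0 with hA
  set B : ℤ := if s b = false then 1 else 0 with hB
  set C : ℤ := (if p a ≠ a ∧ p b ≠ b ∧ p b < p a ∧ s (p a) = false then 1 else 0) -
    (if a < p a ∧ s (p a) = false then 1 else 0) with hC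
  set D : ℤ := (if p a ≠ a ∧ p b ≠ b ∧ p a < p b ∧ s (p b) = false then 1 else 0) -
    (if b < p b ∧ s (p b) = false then 1 else 0) with hD
  have key : ∀ y, (if capPartner p a b y < y ∧ s y = false then (1 : ℤ) else 0) =
      (if p y < y ∧ t y = false then 1 else 0) + (if y = a then -A else 0) +
      (if y = b then B else 0) + (if y = p a then (if p a = a then 0 else C) else 0) +
      (if y = p b then (if p b = b then 0 else D) else 0) := by
    intro y
    have i1 := h.invol y
    have hty := ht y
    unfold capPartner
    by_cases hya : y = a
    · subst hya
      have : ¬ b < y := hlt.not_gt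
      have f6 : ¬ y = p b := fun e => f5 e.symm
      by_cases e : y = p y
      · simp [f6, hne, this, hA, ← e]
      · simp [f6, hne, this, hA, e]
    by_cases hyb : y = b
    · subst hyb
      have f6 : ¬ y = p a := fun e => f4 e.symm
      have : ¬ p y < y := not_lt.mpr f2
      by_cases e : y = p y
      · simp [f6, hya, hB, ← e, hlt]
      · simp [f6, hya, hB, e, hlt, this]
    rw [hty hya hyb]
    by_cases hpa : p y = a
    · have e : p a = y := by rw [← hpa, i1]
      have e' : y ≠ p b := fun e' => hne (by rw [← hpa, e', i3])
      simp only [hya, hyb, hpa, e, e', hC, if_true, if_false]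
      grind
    by_cases hpb : p y = b
    · have e : p b = y := by rw [← hpb, i1]
      have e' : y ≠ p a := fun e' => hpa (by rw [e', i2])
      simp only [hya, hyb, hpb, e, e', hD, if_true, if_false]
      grind
    have e1 : y ≠ p a := fun e => hpa (by rw [e, i2])
    have e2 : y ≠ p b := fun e => hpb (by rw [e, i3])
    simp [hya, hyb, hpa, hpb, e1, e2]
  unfold capDeg
  rw [Finset.sum_congr rfl fun y _ => key y]
  simp only [Finset.sum_add_distrib, Finset.sum_ite_eq', Finset.mem_univ, if_true]
  have n1 := h.noncrossing a b hlt
  have n2 := h.through a b hlt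
  have hFa : p a < a → (A = if forcedSign p b s = false then 1 else 0) := by
    intro e
    rw [hA, hta e]; simp [e]
  have hFa' : ¬ p a < a → A = 0 := by
    intro e
    rw [hA]; simp [e]
  have : -A + (if p a = a then 0 else C) + (if p b = b then 0 else D) =
      - (if forcedSign p b s = false then 1 else 0) := by
    unfold forcedSign at *
    by_cases e1 : p b = b
    · have e3 : p a ≤ a := by
        by_contra e; push Not at e
        have : b < p a := lt_of_le_of_ne (by rw [Fin.le_def]; rw [Fin.lt_def] at e; omega)
          (Ne.symm f4)
        exact n2 this e1
      simp only [e1, if_true, hC] at *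
      by_cases e2 : p a = a
      · simp [hA, e2]
      · have := lt_of_le_of_ne e3 e2
        simp [hFa this, this.not_gt]
    · have e3 : b < p b := lt_of_le_of_ne f2 (Ne.symm e1)
      simp only [e1, if_false, hC, hD] at *
      rcases lt_trichotomy (p a) a with e2 | e2 | e2
      · have e4 : p a < p b := e2.trans (hlt.trans e3)
        simp [hFa e2, e2.ne, e3, e3.ne', e4, e4.not_gt, e2.not_gt]
      · simp [hFa' (by rw [e2]; simp), e2, e3]
      · have e5 : b < p a := lt_of_le_of_ne (by rw [Fin.le_def]; rw [Fin.lt_def] at e2; omega)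
          (Ne.symm f4)
        have e4 := (n1 e5).2
        simp [hFa' e2.not_gt, e2.ne', e2, e3, e3.ne', e4, e4.not_gt]
  linarith

end stack

open Classical in
/-- The monomial attached to the signs `s` on a cap diagram. -/
noncomputable def capWeight {m : ℕ} (p : Fin m → Fin m) (d : Fin m → Bool) (s : Fin m → Bool) :
    ℤ[T;T⁻¹] :=
  if CapOriented p d s then LaurentPolynomial.T (capDeg p s) else 0

/-! ### The recursion for the weights of oriented cap diagrams. -/

section weight

variable {m : ℕ} {p : Fin m → Fin m} {d : Fin m → Bool} {a b : Fin m} {c : Bool}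

theorem capWeight_stack_of_forcedSign {s t t' : Fin m → Bool} (h : IsCap p d)
    (hab : a.val + 1 = b.val)
    (f1 : d b = false) (f2 : b ≤ p b) (f3 : d a = true ∨ p a < a) (f4 : p a ≠ b)
    (hc' : c = true → d a = true) (hc : c = false → s a ≠ s b)
    (ht : ∀ x, x ≠ a → x ≠ b → t x = s x) (hb : t b = !forcedSign p b s)
    (hta : t a = forcedSign p b s ∨ (d a = true ∧ ¬ p a < a))
    (ht' : ∀ x, x ≠ a → x ≠ b → t' x = s x) (hb' : t' b = forcedSign p b s) :
    capWeight p d t' = 0 ∧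
    capWeight (capPartner p a b) (capBead p d a b c) s =
      LaurentPolynomial.T (if s b = false then 1 else 0) * (capWeight p d t *
        LaurentPolynomial.T (if forcedSign p b s = false then -1 else 0)) := by
  have f5 : p b ≠ a := fun e => f4 (by rw [← e, h.invol])
  have n := not_capOriented_of_forcedSign (t := t') (s := s) f1 f5 ht' hb'
  have o := capOriented_stack_iff (c := c) h hab f1 f2 f3 f4 hc' ht hb (fun e => by grind)
  have g := capDeg_stack h hab f1 f2 f3 f4 ht hb (fun e => by grind)
  refine ⟨by simp [capWeight, n], ?_⟩
  unfold capWeight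
  by_cases ho : CapOriented p d t
  · rw [if_pos (o.2 ⟨hc, ho⟩), if_pos ho, g, ← LaurentPolynomial.T_add, ← LaurentPolynomial.T_add]
    congr 1
    split_ifs <;> ring
  · rw [if_neg (fun e => ho (o.1 e).2), if_neg ho]
    simp

/-- The signs `t` and `t'` differ at `b`, so exactly one of them has the sign prescribed by the
strand at `b`, and the other has weight zero. The right-hand side is the sum over the edges of the
Bruhat graph that end at `s`. The second alternative in `hta'` serves `s_{1'}`, where `a` is
position 0 and its sign never changes. -/
theorem capWeight_stack {s t t' : Fin m → Bool} (h : IsCap p d)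
    (hab : a.val + 1 = b.val)
    (f1 : d b = false) (f2 : b ≤ p b) (f3 : d a = true ∨ p a < a) (f4 : p a ≠ b)
    (hc' : c = true → d a = true) (hc : c = false → s a ≠ s b)
    (ht : ∀ x, x ≠ a → x ≠ b → t x = s x) (hb : t b = false) (hta : t a = true)
    (ht' : ∀ x, x ≠ a → x ≠ b → t' x = s x) (hb' : t' b = true)
    (hta' : t' a = false ∨ (d a = true ∧ ¬ p a < a)) :
    capWeight (capPartner p a b) (capBead p d a b c) s =
      LaurentPolynomial.T (if s b = false then 1 else 0) *
        (capWeight p d t + LaurentPolynomial.T (-1) * capWeight p d t') := by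
  cases hf : forcedSign p b s
  · have := capWeight_stack_of_forcedSign (c := c) (s := s) (t := t') (t' := t) h hab f1 f2 f3 f4
      hc' hc ht' (by simp [hf, hb']) (by simpa [hf] using hta') ht (by simp [hf, hb])
    rw [this.2, this.1, hf]
    simp only [if_true]
    ring
  · have := capWeight_stack_of_forcedSign (c := c) (s := s) (t := t) (t' := t') h hab f1 f2 f3 f4
      hc' hc ht (by simp [hf, hb]) (by simp [hf, hta]) ht' (by simp [hf, hb'])
    rw [this.2, this.1, hf]
    simp

theorem capWeight_stack_eq_zero {s : Fin m → Bool} (hab : a.val + 1 = b.val) (hs : s a = s b) :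
    capWeight (capPartner p a b) (capBead p d a b false) s = 0 := by
  have hlt : b ≠ a := by intro e; rw [e] at hab; omega
  unfold capWeight
  rw [if_neg]
  intro o
  have := (o a (by simp [capBead])).2
  simp [capPartner, hlt, hs] at this

end weight

/-! ### A cap diagram is determined by its sign vector -/

section unique

variable {m : ℕ} {p p' : Fin m → Fin m} {d d' s : Fin m → Bool}

/-- Bracket matching, by induction on the width of the arc. The positions inside are matched among
themselves in the same way by `p'`, so `x` cannot be joined to any of them. If `x` were a through
strand or had a partner beyond `p x`, then the `∧` at `p x` would force a crossing, an enclosed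
through strand or a bead that is not exposed. -/
theorem IsCap.arc_eq_of_hasShape (h : IsCap p d) (h' : IsCap p' d') (hs : HasShape p d s)
    (hs' : HasShape p' d' s) (k : ℕ) (x : Fin m) (hk : (p x).val - x.val ≤ k) (hx : x < p x)
    (hd : d x = false) : p' x = p x := by
  induction k generalizing x with
  | zero => rw [Fin.lt_def] at hx; omega
  | succ k ih =>
    have inner : ∀ w, x < w → w < p x → p' w = p w := by
      intro w h1 h2
      have n1 := h.noncrossing x w h1 h2
      have n2 := h.through x w h1 h2
      have n3 := h.exposed x w h1 h2
      have n4 := h.bead w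
      have n5 := h.invol w
      rcases lt_or_gt_of_ne n2 with n6 | n6
      · have := ih (p w) (by rw [n5]; simp only [Fin.lt_def] at *; omega) (by rwa [n5])
          (by rw [n4, n3])
        rw [← h'.invol (p w), this, n5]
      · exact ih w (by simp only [Fin.lt_def] at *; omega) n6 n3
    have sx : s x = false := by rw [hs x, hd]; simp [hx.not_gt]
    have sy : s (p x) = true := by rw [hs (p x), h.invol]; simp [hx]
    rw [hs' x] at sx
    rw [hs' (p x)] at sy
    simp only [Bool.or_eq_false_iff, decide_eq_false_iff_not, not_lt] at sx
    simp only [Bool.or_eq_true, decide_eq_true_eq] at sy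
    rcases lt_trichotomy (p' x) (p x) with e | e | e
    · rcases sx.2.lt_or_eq with e1 | e1
      · have := inner _ e1 e
        rw [h'.invol] at this
        have : p x = p' x := by rw [← h.invol (p' x), ← this]
        rw [this]
      · have e1' := e1.symm
        rcases sy with e2 | e2
        · exact absurd (h'.left x _ e1' e2) (not_le.mpr hx)
        · rcases lt_trichotomy (p' (p x)) x with e3 | e3 | e3
          · exact absurd e1' (h'.through _ _ e3 (by rw [h'.invol]; exact hx))
          · rw [← h'.invol (p x), e3]
          · have := inner _ e3 e2
            rw [h'.invol] at this
            have : x = p' (p x) := by rw [← h.invol (p' (p x)), ← this, h.invol]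
            exact absurd this e3.ne
    · exact e
    · rcases sy with e2 | e2
      · have := h'.exposed x _ hx e
        rw [e2] at this
        exact absurd this (by simp)
      · rcases lt_trichotomy (p' (p x)) x with e3 | e3 | e3
        · have := (h'.noncrossing _ _ e3 (by rw [h'.invol]; exact hx)).2
          rw [h'.invol] at this
          exact absurd this e.not_gt
        · rw [← h'.invol (p x), e3]
        · have := inner _ e3 e2
          rw [h'.invol] at this
          have : x = p' (p x) := by rw [← h.invol (p' (p x)), ← this, h.invol]
          exact absurd this e3.ne

theorem IsCap.partner_eq_of_not_bead (h : IsCap p d) (h' : IsCap p' d') (hs : HasShape p d s)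
    (hs' : HasShape p' d' s) (x : Fin m) (hx : p x ≠ x) (hd : d x = false) : p' x = p x := by
  rcases lt_or_gt_of_ne hx with e | e
  · have := h.arc_eq_of_hasShape h' hs hs' _ (p x) le_rfl (by rw [h.invol]; exact e)
      (by rw [h.bead, hd])
    rw [← h'.invol (p x), this, h.invol]
  · exact h.arc_eq_of_hasShape h' hs hs' _ x le_rfl e hd

/-- An unbeaded `∧` is the right end of an unbeaded arc starting at a `∨`. That arc would occur in
the other diagram as well, where a beaded strand has no `∨`. -/
theorem IsCap.bead_of_hasShape (h : IsCap p d) (h' : IsCap p' d') (hs : HasShape p d s)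
    (hs' : HasShape p' d' s) (x : Fin m) (hd : d x = true) : d' x = true := by
  by_contra hx
  rw [Bool.not_eq_true] at hx
  have sx : s x = true := by rw [hs x, hd]; rfl
  rw [hs' x, hx] at sx
  simp only [Bool.false_or, decide_eq_true_eq] at sx
  have e := h'.partner_eq_of_not_bead h hs' hs x sx.ne hx
  have := hs (p' x)
  rw [hs' (p' x), h'.invol, h'.bead, hx, ← e, h.bead, hd] at this
  rw [← e] at sx
  simp [sx.not_gt] at this

/-- A beaded vertex can neither be enclosed by an arc nor lie to the right of a through strand. -/
theorem IsCap.not_lt_of_bead (h : IsCap p d) (h' : IsCap p' d) (x : Fin m) (hx : x ≤ p x)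
    (hd : d x = true) : ¬ p x < p' x := by
  intro hlt
  rcases hx.lt_or_eq with e | e
  · have := h'.exposed x _ e hlt
    rw [h.bead, hd] at this
    exact absurd this (by simp)
  · have := h.left x (p' x) e.symm (by rw [h'.bead, hd])
    rw [← e] at hlt
    exact absurd this (not_le.mpr hlt)

theorem IsCap.eq_of_hasShape (h : IsCap p d) (h' : IsCap p' d') (hs : HasShape p d s)
    (hs' : HasShape p' d' s) : p = p' ∧ d = d' := by
  have hdd : d = d' := by
    funext x
    have h1 := h.bead_of_hasShape h' hs hs' x
    have h2 := h'.bead_of_hasShape h hs' hs x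
    cases e1 : d x <;> cases e2 : d' x <;> simp_all
  subst hdd
  refine ⟨?_, rfl⟩
  -- Beaded strands are matched from the left: a right end is settled by its left end, and for a
  -- left end or through strand neither diagram may reach farther than the other.
  have hdec : ∀ k, ∀ x : Fin m, x.val ≤ k → d x = true → p x = p' x := by
    intro k
    induction k using Nat.strong_induction_on with
    | _ k ih =>
      intro x hk hx
      rcases lt_or_ge (p x) x with e | e
      · have := ih (p x).val (by rw [Fin.lt_def] at e; omega) (p x) le_rfl (by rw [h.bead, hx])
        rw [h.invol] at this
        rw [← h'.invol (p x), ← this]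
      rcases lt_or_ge (p' x) x with e' | e'
      · have := ih (p' x).val (by rw [Fin.lt_def] at e'; omega) (p' x) le_rfl
          (by rw [h'.bead, hx])
        rw [h'.invol] at this
        rw [← h.invol (p' x), this]
      exact le_antisymm (not_lt.mp (h'.not_lt_of_bead h x e' hx))
        (not_lt.mp (h.not_lt_of_bead h' x e hx))
  funext x
  cases hx : d x
  · by_cases e : p x = x
    · by_cases e' : p' x = x
      · rw [e, e']
      · exact h'.partner_eq_of_not_bead h hs' hs x e' hx
    · exact (h.partner_eq_of_not_bead h' hs hs' x e hx).symm
  · exact hdec _ x le_rfl hx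

end unique

/-! ### Factorisation of oriented cap diagrams -/

section factor

variable {n : ℕ} {p : Fin (n + 1) → Fin (n + 1)} {d s : Fin (n + 1) → Bool}

/-- Every beaded strand which does not end at position `0` is flip-oriented. -/
def CapStandard (p : Fin (n + 1) → Fin (n + 1)) (d s : Fin (n + 1) → Bool) : Prop :=
  ∀ x, d x = true → (p x = x → x ≠ 0 → s x = true) ∧
    (p x ≠ x → x ≠ 0 → p x ≠ 0 → s x = s (p x))

/-- The beads which are left when only the strands with two signs `∧` keep theirs. -/
def restrictBead (p : Fin (n + 1) → Fin (n + 1)) (d s : Fin (n + 1) → Bool)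
    (x : Fin (n + 1)) : Bool :=
  d x && s x && s (p x)

/-- The weight of degree zero through which the orientation `s` factors. -/
def middleSign (p : Fin (n + 1) → Fin (n + 1)) (s : Fin (n + 1) → Bool) (x : Fin (n + 1)) : Bool :=
  if x = 0 ∨ p x < x then true else if p x = x then s x else s x == s (p x)

theorem IsCap.restrictBead (h : IsCap p d) (s : Fin (n + 1) → Bool) :
    IsCap p (restrictBead p d s) where
  invol := h.invol
  bead x := by
    simp only [TypeC.restrictBead, h.invol, h.bead]
    cases d x <;> cases s x <;> cases s (p x) <;> rfl
  noncrossing := h.noncrossing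
  through := h.through
  exposed x y h1 h2 := by simp [TypeC.restrictBead, h.exposed x y h1 h2]
  left x y h1 h2 := h.left x y h1 (by
    simp only [TypeC.restrictBead, Bool.and_eq_true] at h2
    exact h2.1.1)

theorem capDeg_eq_zero_iff : capDeg p s = 0 ↔ ∀ x, p x < x → s x = true := by
  unfold capDeg
  rw [Finset.sum_eq_zero_iff_of_nonneg (fun _ _ => by split_ifs <;> simp)]
  simp

/-- In degree zero every right end is `∧`. A left end with `∨` must lose any bead, a beaded left end
with `∧` keeps it, and a through strand keeps its bead exactly if its sign is `∧`. -/
theorem hasShape_restrictBead (h : IsCap p d) (ho : CapOriented p d s) (h0 : capDeg p s = 0) :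
    HasShape p (restrictBead p d s) s := by
  rw [capDeg_eq_zero_iff] at h0
  intro x
  have o := ho x
  have h1 := h0 x
  have h2 := h0 (p x)
  rw [h.invol] at h2
  unfold restrictBead
  rcases lt_trichotomy (p x) x with e | e | e
  · simp [e, h1 e]
  · simp only [e, lt_self_iff_false, decide_false, Bool.or_false]
    cases hd : d x
    · simp [(o hd).1 e]
    · simp
  · simp only [h2 e, e.not_gt, decide_false, Bool.or_false, Bool.and_true]
    cases hd : d x
    · have := (o hd).2 e.ne'
      rw [h2 e] at this
      simpa using this
    · simp

/-- Uniqueness of the factorisation: away from position 0, unbeaded strands are oriented and beaded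
ones flip-oriented by `s`, so `s` determines the beads `e`, and with them the shape `t`. -/
theorem eq_middleSign {e t : Fin (n + 1) → Bool} (ht : HasShape p e t) (h0 : t 0 = true)
    (ho : CapOriented p e s) (hs : CapStandard p e s) :
    t = middleSign p s := by
  funext x
  unfold middleSign
  have t1 := ht x
  by_cases hx0 : x = 0
  · simp [hx0, h0]
  have hpx : p x < x ∨ p x ≠ 0 := by
    by_cases e : p x = 0
    · left; rw [e]; exact Fin.pos_of_ne_zero hx0
    · right; exact e
  by_cases e1 : p x < x
  · simp [e1, t1]
  have e2 : p x ≠ 0 := hpx.resolve_left e1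
  by_cases e3 : p x = x
  · simp only [hx0, e3, lt_self_iff_false, or_self, if_false, if_true, t1, decide_false,
      Bool.or_false]
    cases hd : e x
    · exact ((ho x hd).1 e3).symm
    · exact ((hs x hd).1 e3 hx0).symm
  · simp only [hx0, e1, e3, or_self, if_false, t1, decide_false, Bool.or_false]
    cases hd : e x
    · have := (ho x hd).2 e3
      simpa using this
    · have := (hs x hd).2 e3 hx0 e2
      simp [this]

theorem capOriented_middleSign (h : IsCap p d) (hd0 : d 0 = true) (ho : CapOriented p d s) :
    CapOriented p d (middleSign p s) := by
  intro x hx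
  have hx0 : x ≠ 0 := fun e => by rw [e, hd0] at hx; exact absurd hx (by simp)
  have hp0 : p x ≠ 0 := fun e => by rw [← h.bead, e, hd0] at hx; exact absurd hx (by simp)
  have o := ho x hx
  have i := h.invol x
  refine ⟨fun e => ?_, fun e => ?_⟩
  · simp [middleSign, hx0, e, o.1 e]
  · have o2 := o.2 e
    rcases lt_or_gt_of_ne e with e1 | e1
    · simp [middleSign, hx0, hp0, e1, i, e1.ne', e1.not_gt, o2.symm]
    · simp [middleSign, hx0, hp0, e1, i, e1.ne', e1.not_gt, o2]

theorem capDeg_middleSign : capDeg p (middleSign p s) = 0 := by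
  rw [capDeg_eq_zero_iff]
  intro x hx
  simp [middleSign, hx]

/-- Restriction removes a bead only where `middleSign` has a `∨`. This happens at a left end whose
arc is oriented by `s`, or at a through strand with sign `∨`. -/
theorem capOriented_restrictBead_middleSign (h : IsCap p d)
    (ho : CapOriented p d s) :
    CapOriented p (restrictBead p d (middleSign p s)) s := by
  intro x hx
  have i := h.invol x
  cases hd : d x
  · exact ho x hd
  · simp only [restrictBead, hd, Bool.true_and, Bool.and_eq_false_iff] at hx
    unfold middleSign at hx
    rw [i] at hx
    refine ⟨fun e => ?_, fun e => ?_⟩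
    · simp only [e, lt_self_iff_false, or_false, if_true, or_self] at hx
      by_cases hx0 : x = 0 <;> simp_all
    · rcases lt_or_gt_of_ne e with e1 | e1
      · simp only [e1, or_true, if_true, e1.not_gt, e1.ne', or_false, if_false] at hx
        by_cases hx0 : p x = 0
        · simp [hx0] at hx
        · simp only [hx0, if_false, Bool.true_eq_false, false_or, beq_eq_false_iff_ne] at hx
          exact hx.symm
      · simp only [e1, or_true, if_true, e1.not_gt, e1.ne', or_false, if_false] at hx
        by_cases hx0 : x = 0 <;> simp_all

theorem capStandard_restrictBead_middleSign (h : IsCap p d) :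
    CapStandard p (restrictBead p d (middleSign p s)) s := by
  intro x hx
  have i := h.invol x
  simp only [restrictBead, Bool.and_eq_true] at hx
  unfold middleSign at hx
  rw [i] at hx
  refine ⟨fun e hx0 => ?_, fun e hx0 hp0 => ?_⟩
  · have := hx.1.2
    simpa [e, hx0] using this
  · rcases lt_or_gt_of_ne e with e1 | e1
    · have := hx.2
      simp [e1.not_gt, hp0, e1.ne'] at this
      exact this.symm
    · have := hx.1.2
      simpa [e1.not_gt, hx0, e1.ne'] using this

end factor

/-! ### Sign vectors of signed permutations -/

/-- The sign vector of a signed permutation, with `true` for `∧`.  The entry at position `0` is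
`true` by convention. -/
def signVec {n : ℕ} (w : Grp n) : Fin (n + 1) → Bool :=
  Fin.cases true fun k => decide ((w.1 (1, k)).1 = -1)

/-- The action of a simple reflection on sign vectors. -/
def signStep {n : ℕ} (j : Fin n) (s : Fin (n + 1) → Bool) (x : Fin (n + 1)) : Bool :=
  if j.val = 0 then (if x = j.succ then !s x else s x)
  else s (Equiv.swap j.castSucc j.succ x)

/-- The sum of the positions of the symbols `∧`. -/
def height {n : ℕ} (s : Fin (n + 1) → Bool) : ℕ :=
  ∑ k : Fin (n + 1), if s k then k.val else 0

section group

variable {n : ℕ}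

@[simp] theorem signVec_zero (w : Grp n) : signVec w 0 = true := rfl

theorem signVec_succ (w : Grp n) (k : Fin n) :
    signVec w k.succ = decide ((w.1 (1, k)).1 = -1) := rfl

theorem signVec_one_succ (k : Fin n) : signVec (1 : Grp n) k.succ = false := by
  simp [signVec_succ]

theorem apply_neg (w : Grp n) (e : ℤˣ) (k : Fin n) :
    w.1 (-e, k) = (-(w.1 (e, k)).1, (w.1 (e, k)).2) := by
  have h := Subgroup.mem_centralizer_singleton_iff.mp w.2
  have := congrArg (fun f : Equiv.Perm (ℤˣ × Fin n) => f (e, k)) h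
  simpa [signFlip, Prod.map] using this

/-- Right multiplication acts on positions, so it permutes the signs or flips the one at position 1.
-/
theorem signVec_mul_simple (w : Grp n) (j : Fin n) :
    signVec (w * simple j) = signStep j (signVec w) := by
  funext x
  refine Fin.cases ?_ (fun k => ?_) x
  · unfold signStep
    split_ifs with h1 h2
    · exact absurd h2 (Fin.succ_ne_zero j).symm
    · rfl
    · rw [Equiv.swap_apply_of_ne_of_ne]
      · simp
      · intro e
        apply h1
        have := congrArg Fin.val e
        simpa using this.symm
      · exact (Fin.succ_ne_zero j).symm
  · unfold signStep
    split_ifs with h1 h2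
    · have h2 : k = j := Fin.succ_injective _ h2
      subst h2
      rw [signVec_succ, signVec_succ]
      simp only [simple, Subgroup.coe_mul, Equiv.Perm.mul_apply, simplePerm, h1, if_true,
        Equiv.coe_fn_mk]
      rw [apply_neg]
      rcases Int.units_eq_one_or (w.1 (1, k)).1 with e | e <;> simp [e]
    · have h2 : k ≠ j := fun e => h2 (by rw [e])
      rw [signVec_succ, signVec_succ]
      simp [simple, simplePerm, h1, h2]
    · have e0 : j.castSucc = (⟨j.val - 1, lt_of_le_of_lt (Nat.sub_le _ _) j.isLt⟩ : Fin n).succ := by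
        ext; simp; omega
      rw [e0, (Fin.succ_injective n).swap_apply, signVec_succ, signVec_succ]
      simp [simple, simplePerm, h1]

theorem parabolic_fst {g : Grp n} (hg : g ∈ parabolic n) (x : ℤˣ × Fin n) :
    (g.1 x).1 = x.1 := by
  unfold parabolic at hg
  induction hg using Subgroup.closure_induction generalizing x with
  | mem g hg =>
    obtain ⟨j, h1, rfl⟩ := hg
    simp [simple, simplePerm, h1]
  | one => rfl
  | mul g h _ _ ig ih =>
    rw [Subgroup.coe_mul, Equiv.Perm.mul_apply, ig, ih]
  | inv g _ ig =>
    have := ig ((g⁻¹).1 x)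
    rw [← this]
    simp

theorem signVec_mul_of_mem_parabolic {g : Grp n} (hg : g ∈ parabolic n) (w : Grp n) :
    signVec (g * w) = signVec w := by
  funext x
  refine Fin.cases rfl (fun k => ?_) x
  rw [signVec_succ, signVec_succ, Subgroup.coe_mul, Equiv.Perm.mul_apply, parabolic_fst hg]

/-- The signed permutation which permutes the positive letters. -/
def unsigned (n : ℕ) : Equiv.Perm (Fin n) →* Grp n where
  toFun f := ⟨Equiv.prodCongr (Equiv.refl ℤˣ) f, by
    rw [Subgroup.mem_centralizer_singleton_iff]
    rfl⟩
  map_one' := rfl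
  map_mul' _ _ := rfl

theorem unsigned_mem_parabolic (f : Equiv.Perm (Fin n)) : unsigned n f ∈ parabolic n := by
  cases n with
  | zero =>
    rw [Subsingleton.elim f 1, map_one]
    exact one_mem _
  | succ n =>
    have hf : f ∈ Submonoid.closure
        (Set.range fun i : Fin n => Equiv.swap i.castSucc i.succ) := by
      rw [Equiv.Perm.mclosure_swap_castSucc_succ]; trivial
    induction hf using Submonoid.closure_induction with
    | mem f hf =>
      obtain ⟨i, rfl⟩ := hf
      apply Subgroup.subset_closure
      refine ⟨i.succ, by simp, ?_⟩
      apply Subtype.ext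
      simp only [simple, simplePerm, Fin.val_succ, Nat.add_eq_zero_iff, one_ne_zero, and_false,
        if_false, Nat.add_sub_cancel]
      rfl
    | one => rw [map_one]; exact one_mem _
    | mul f g _ _ hf hg => rw [map_mul]; exact mul_mem hf hg

/-- A sign-preserving element is a permutation of the positive letters, and neighbouring
transpositions generate the symmetric group. So cosets of `P` correspond to sign vectors. -/
theorem mem_parabolic_of_fst {g : Grp n} (hg : ∀ x : ℤˣ × Fin n, (g.1 x).1 = x.1) :
    g ∈ parabolic n := by
  have indep : ∀ (w : Grp n) (e : ℤˣ) (k : Fin n), (w.1 (e, k)).2 = (w.1 (1, k)).2 := by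
    intro w e k
    rcases Int.units_eq_one_or e with rfl | rfl
    · rfl
    · rw [apply_neg]
  have inv : ∀ w : Grp n, ∀ x, w.1 ((w⁻¹).1 x) = x := by
    intro w x; simp
  have inv' : ∀ w : Grp n, ∀ x, (w⁻¹).1 (w.1 x) = x := by
    intro w x; simp
  let f : Equiv.Perm (Fin n) :=
    { toFun := fun k => (g.1 (1, k)).2
      invFun := fun k => ((g⁻¹).1 (1, k)).2
      left_inv := by
        intro k
        dsimp only
        rw [← indep g⁻¹ (g.1 (1, k)).1, Prod.mk.eta, inv']
      right_inv := by
        intro k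
        dsimp only
        rw [← indep g ((g⁻¹).1 (1, k)).1, Prod.mk.eta, inv] }
  have : g = unsigned n f := by
    apply Subtype.ext
    apply Equiv.ext
    rintro ⟨e, k⟩
    refine Prod.ext (hg _) (indep _ _ _)
  rw [this]
  exact unsigned_mem_parabolic f

theorem mul_inv_mem_parabolic {v w : Grp n} (h : signVec v = signVec w) :
    v * w⁻¹ ∈ parabolic n := by
  have key : ∀ x : ℤˣ × Fin n, (v.1 x).1 = (w.1 x).1 := by
    have h1 : ∀ k, (v.1 (1, k)).1 = (w.1 (1, k)).1 := by
      intro k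
      have := congrFun h k.succ
      rw [signVec_succ, signVec_succ, decide_eq_decide] at this
      rcases Int.units_eq_one_or (v.1 (1, k)).1 with e | e <;>
      rcases Int.units_eq_one_or (w.1 (1, k)).1 with e' | e' <;> simp_all
    rintro ⟨e, k⟩
    rcases Int.units_eq_one_or e with rfl | rfl
    · exact h1 k
    · rw [apply_neg, apply_neg, h1]
  apply mem_parabolic_of_fst
  intro x
  rw [Subgroup.coe_mul, Equiv.Perm.mul_apply, key, ← Equiv.Perm.mul_apply, ← Subgroup.coe_mul]
  simp

/-! ### Heights and lengths -/

/-- The simple reflection `j` raises the sign vector `s`. -/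
def Raises (j : Fin n) (s : Fin (n + 1) → Bool) : Prop :=
  s j.castSucc = true ∧ s j.succ = false

theorem castSucc_eq_zero {j : Fin n} (hj : j.val = 0) : j.castSucc = 0 := Fin.ext hj

theorem signStep_signStep (j : Fin n) (s : Fin (n + 1) → Bool) :
    signStep j (signStep j s) = s := by
  funext x
  unfold signStep
  split_ifs <;> simp

/-- An `∧` moves one place to the right. For `s_{1'}` the `∧` at position 0 also stays behind, but
it has weight 0 in the height. -/
theorem height_signStep_of_raises {j : Fin n} {s : Fin (n + 1) → Bool} (h : Raises j s) :
    height (signStep j s) = height s + 1 := by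
  unfold height
  have hne : j.castSucc ≠ j.succ := Fin.castSucc_lt_succ.ne
  have hs : ∀ t : Fin (n + 1) → Bool, (∑ k : Fin (n + 1), if t k then k.val else 0) =
      (if t j.castSucc then j.val else 0) + ((if t j.succ then j.val + 1 else 0) +
      ∑ k ∈ (Finset.univ.erase j.castSucc).erase j.succ, if t k then k.val else 0) := by
    intro t
    rw [← Finset.add_sum_erase _ _ (Finset.mem_univ j.castSucc),
      ← Finset.add_sum_erase _ _ (Finset.mem_erase.2 ⟨hne.symm, Finset.mem_univ j.succ⟩)]
    simp
  rw [hs, hs s, h.1, h.2]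
  have hrest : ∀ k ∈ (Finset.univ.erase j.castSucc).erase j.succ,
      (if signStep j s k then k.val else 0) = if s k then k.val else 0 := by
    intro k hk
    simp only [Finset.mem_erase] at hk
    simp [signStep, hk.1, Equiv.swap_apply_of_ne_of_ne hk.2.1 hk.1]
  rw [Finset.sum_congr rfl hrest]
  by_cases hj : j.val = 0
  · simp [signStep, hj, h.2, hne]; ring
  · simp [signStep, hj, h.1, h.2]; ring

theorem raises_trichotomy (j : Fin n) (s : Fin (n + 1) → Bool) (h0 : s 0 = true) :
    Raises j s ∨ Raises j (signStep j s) ∨ (signStep j s = s ∧ j.val ≠ 0 ∧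
      s j.castSucc = s j.succ) := by
  have hne : j.castSucc ≠ j.succ := Fin.castSucc_lt_succ.ne
  unfold Raises
  by_cases hj : j.val = 0
  · have h1 : s j.castSucc = true := by rw [castSucc_eq_zero hj, h0]
    cases h : s j.succ <;> simp [signStep, hj, h1, h, hne]
  · cases h1 : s j.castSucc <;> cases h2 : s j.succ <;> simp [signStep, hj, h1, h2]
    all_goals
      funext x
      by_cases e : x = j.castSucc
      · rw [e]; simp [signStep, hj, h1, h2]
      by_cases e' : x = j.succ
      · rw [e']; simp [signStep, hj, h1, h2]
      rw [signStep, if_neg hj, Equiv.swap_apply_of_ne_of_ne e e']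

theorem signStep_zero (j : Fin n) (s : Fin (n + 1) → Bool) : signStep j s 0 = s 0 := by
  unfold signStep
  have h2 := (Fin.succ_ne_zero j).symm
  split_ifs with h1
  · rfl
  · rw [Equiv.swap_apply_of_ne_of_ne _ h2]
    intro e
    exact h1 (congrArg Fin.val e).symm

theorem height_signStep_of_raises' {j : Fin n} {s : Fin (n + 1) → Bool}
    (h : Raises j (signStep j s)) : height s = height (signStep j s) + 1 := by
  rw [← height_signStep_of_raises h, signStep_signStep]

theorem height_signStep_le (j : Fin n) (s : Fin (n + 1) → Bool) (h0 : s 0 = true) :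
    height (signStep j s) ≤ height s + 1 := by
  rcases raises_trichotomy j s h0 with h | h | h
  · exact (height_signStep_of_raises h).le
  · have := height_signStep_of_raises' h; omega
  · rw [h.1]; omega

theorem raises_of_height {j : Fin n} {s : Fin (n + 1) → Bool} (h0 : s 0 = true)
    (h : height (signStep j s) = height s + 1) : Raises j s := by
  rcases raises_trichotomy j s h0 with h' | h' | h'
  · exact h'
  · have := height_signStep_of_raises' h'; omega
  · rw [h'.1] at h; omega

theorem wordProd_append_singleton (u : List (Fin n)) (j : Fin n) :
    wordProd (u ++ [j]) = wordProd u * simple j := by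
  simp [wordProd]

theorem height_signVec_one : height (signVec (1 : Grp n)) = 0 := by
  unfold height
  rw [Fin.sum_univ_succ]
  simp [signVec_one_succ]

theorem height_wordProd_le (u : List (Fin n)) : height (signVec (wordProd u)) ≤ u.length := by
  induction u using List.reverseRecOn with
  | nil => exact height_signVec_one.le
  | append_singleton u j ih =>
    rw [wordProd_append_singleton, signVec_mul_simple, List.length_append]
    have := height_signStep_le j (signVec (wordProd u)) rfl
    simp
    omega

/-- If nothing lowers `s`, there is no `∧` at position 1, and an `∧` farther right would need an `∧`
directly to its left. Hence all positions but 0 carry `∨`. -/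
theorem exists_lower {s : Fin (n + 1) → Bool} (h0 : s 0 = true) (hs : height s ≠ 0) :
    ∃ j : Fin n, Raises j (signStep j s) := by
  by_contra hcon
  push Not at hcon
  have hf : ∀ k : ℕ, ∀ hk : k < n, s (Fin.succ ⟨k, hk⟩) = false := by
    intro k
    induction k with
    | zero =>
      intro hk
      by_contra hne
      apply hcon ⟨0, hk⟩
      have hne' : (0 : Fin (n + 1)) ≠ Fin.succ ⟨0, hk⟩ := (Fin.succ_ne_zero _).symm
      refine ⟨?_, ?_⟩
      · rw [castSucc_eq_zero rfl, signStep_zero, h0]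
      · simpa [signStep] using hne
    | succ k ih =>
      intro hk
      by_contra hne
      apply hcon ⟨k + 1, hk⟩
      have := ih (by omega)
      refine ⟨?_, ?_⟩
      · simpa [signStep] using hne
      · simp only [signStep, Nat.add_eq_zero_iff, one_ne_zero, and_false, if_false,
          Equiv.swap_apply_right]
        exact this
  apply hs
  unfold height
  rw [Fin.sum_univ_succ]
  simp [fun k : Fin n => hf k.val k.isLt]

theorem exists_word {s : Fin (n + 1) → Bool} (h0 : s 0 = true) :
    ∃ u : List (Fin n), u.length = height s ∧ signVec (wordProd u) = s := by
  induction hk : height s generalizing s with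
  | zero =>
    refine ⟨[], rfl, ?_⟩
    funext x
    refine Fin.cases (by rw [h0]; rfl) (fun k => ?_) x
    unfold height at hk
    rw [Finset.sum_eq_zero_iff] at hk
    have := hk k.succ (Finset.mem_univ _)
    simp only [Fin.val_succ, ite_eq_right_iff, Nat.add_eq_zero_iff, one_ne_zero, and_false,
      imp_false, Bool.not_eq_true] at this
    rw [this]
    exact signVec_one_succ k
  | succ k ih =>
    obtain ⟨j, hj⟩ := exists_lower h0 (by omega)
    have := height_signStep_of_raises' hj
    obtain ⟨u, hu1, hu2⟩ := ih (s := signStep j s) (by rw [signStep_zero, h0]) (by omega)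
    refine ⟨u ++ [j], by simp [hu1], ?_⟩
    rw [wordProd_append_singleton, signVec_mul_simple, hu2, signStep_signStep]

theorem simple_mul_simple (j : Fin n) : simple j * simple j = (1 : Grp n) := by
  apply Subtype.ext
  apply Equiv.ext
  rintro ⟨e, k⟩
  by_cases hj : j.val = 0
  · by_cases hk : k = j <;> simp [simple, simplePerm, hj, hk]
  · simp [simple, simplePerm, hj]

/-- Every `w` is an element of `P` times a word with the same signs. This matters because `length`
is an infimum of natural numbers, which would be the junk value 0 on an empty set. -/
theorem exists_wordProd (w : Grp n) : ∃ u : List (Fin n), wordProd u = w := by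
  obtain ⟨u, -, hu⟩ := exists_word (s := signVec w) rfl
  have hmem := mul_inv_mem_parabolic hu.symm
  have hgen : ∀ g ∈ parabolic n, ∃ u : List (Fin n), wordProd u = g := by
    have hinv : ∀ j : Fin n, (simple j)⁻¹ = simple j :=
      fun j => inv_eq_of_mul_eq_one_right (simple_mul_simple j)
    intro g hg
    induction hg using Subgroup.closure_induction with
    | mem g hg =>
      obtain ⟨j, -, rfl⟩ := hg
      exact ⟨[j], by simp [wordProd]⟩
    | one => exact ⟨[], rfl⟩
    | mul g h _ _ hg hh =>
      obtain ⟨u, rfl⟩ := hg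
      obtain ⟨v, rfl⟩ := hh
      exact ⟨u ++ v, by simp [wordProd]⟩
    | inv g _ hg =>
      obtain ⟨u, rfl⟩ := hg
      refine ⟨u.reverse, ?_⟩
      simp [wordProd, List.prod_inv_reverse, Function.comp_def, hinv]
  obtain ⟨v, hv⟩ := hgen _ hmem
  refine ⟨v ++ u, ?_⟩
  have : wordProd (v ++ u) = wordProd v * wordProd u := by simp [wordProd]
  rw [this, hv]
  simp

theorem exists_reduced (w : Grp n) : ∃ u : List (Fin n), IsReducedExpr u w := by
  have : {k : ℕ | ∃ u : List (Fin n), u.length = k ∧ wordProd u = w}.Nonempty := by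
    obtain ⟨u, hu⟩ := exists_wordProd w
    exact ⟨_, u, rfl, hu⟩
  obtain ⟨u, h1, h2⟩ := Nat.sInf_mem this
  exact ⟨u, h2, h1⟩

theorem length_wordProd_le (u : List (Fin n)) : length (wordProd u) ≤ u.length :=
  Nat.sInf_le ⟨u, rfl, rfl⟩

theorem height_le_length (w : Grp n) : height (signVec w) ≤ length w := by
  obtain ⟨u, rfl, h⟩ := exists_reduced w
  rw [← h]
  exact height_wordProd_le u

theorem length_mul_simple_le (w : Grp n) (j : Fin n) : length (w * simple j) ≤ length w + 1 := by
  obtain ⟨u, rfl, h⟩ := exists_reduced w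
  rw [← wordProd_append_singleton, ← h]
  have := length_wordProd_le (u ++ [j])
  simpa using this

/-- Height is constant on `P w` and bounds the length from below. The bound is attained, since
`exists_word` gives an expression of length equal to the height in the same coset. -/
theorem isMin_iff (w : Grp n) :
    (∀ p ∈ parabolic n, length w ≤ length (p * w)) ↔ length w = height (signVec w) := by
  constructor
  · intro h
    obtain ⟨u, h1, h2⟩ := exists_word (s := signVec w) rfl
    have := h _ (mul_inv_mem_parabolic h2)
    rw [inv_mul_cancel_right] at this
    have := length_wordProd_le u
    have := height_le_length w
    omega
  · intro h p hp
    rw [h, ← signVec_mul_of_mem_parabolic hp]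
    exact height_le_length _

theorem simple_comm {i j : Fin n} (h : i.val + 1 < j.val) :
    (simple i * simple j : Grp n) = simple j * simple i := by
  have hj : j.val ≠ 0 := by omega
  apply Subtype.ext
  apply Equiv.ext
  rintro ⟨e, k⟩
  have hij : i ≠ j := fun e => by rw [e] at h; omega
  by_cases hi : i.val = 0
  · have h1 : Equiv.swap (⟨j.val - 1, lt_of_le_of_lt (Nat.sub_le _ _) j.isLt⟩ : Fin n) j i = i :=
      Equiv.swap_apply_of_ne_of_ne (by rw [Ne, Fin.ext_iff]; simp; omega) hij
    by_cases hk : k = i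
    · subst hk
      simp [simple, simplePerm, hi, hj, h1]
    · have h2 : Equiv.swap (⟨j.val - 1, lt_of_le_of_lt (Nat.sub_le _ _) j.isLt⟩ : Fin n) j k ≠ i := by
        intro e'
        apply hk
        rw [← h1] at e'
        exact Equiv.injective _ e'
      simp [simple, simplePerm, hi, hj, hk, h2]
  · have := Equiv.Perm.Disjoint.commute (f := Equiv.swap
        (⟨i.val - 1, lt_of_le_of_lt (Nat.sub_le _ _) i.isLt⟩ : Fin n) i)
      (g := Equiv.swap (⟨j.val - 1, lt_of_le_of_lt (Nat.sub_le _ _) j.isLt⟩ : Fin n) j) (by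
        intro x
        by_cases h1 : x.val < i.val + 1
        · right
          apply Equiv.swap_apply_of_ne_of_ne <;> rw [Ne, Fin.ext_iff] <;> (try simp) <;> omega
        · left
          apply Equiv.swap_apply_of_ne_of_ne <;> rw [Ne, Fin.ext_iff] <;> (try simp) <;> omega)
    have h2 := congrArg (fun f : Equiv.Perm (Fin n) => f k) this
    simpa [simple, simplePerm, hi, hj] using h2

theorem signStep_apply_of_ne {j : Fin n} {s : Fin (n + 1) → Bool} {x : Fin (n + 1)}
    (h1 : x ≠ j.castSucc) (h2 : x ≠ j.succ) : signStep j s x = s x := by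
  unfold signStep
  rw [Equiv.swap_apply_of_ne_of_ne h1 h2]
  simp [h2]

theorem lowers_iff (j : Fin n) (s : Fin (n + 1) → Bool) (h0 : s 0 = true) :
    Raises j (signStep j s) ↔ (j.val = 0 ∨ s j.castSucc = false) ∧ s j.succ = true := by
  unfold Raises
  by_cases hj : j.val = 0
  · rw [castSucc_eq_zero hj, signStep_zero, h0]
    simp [signStep, hj]
  · simp [signStep, hj]
    tauto

/-- Removing the last letter of a reduced expression changes the height by at most one, so equality
of length and height passes to the prefix. -/
theorem exists_step {w : Grp n} (h : length w = height (signVec w)) (h0 : length w ≠ 0) :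
    ∃ (v : Grp n) (j : Fin n), w = v * simple j ∧ length v = height (signVec v) ∧
      length w = length v + 1 ∧ Raises j (signVec v) := by
  obtain ⟨u, rfl, hu⟩ := exists_reduced w
  induction u using List.reverseRecOn with
  | nil => exact absurd hu.symm (by simpa using h0)
  | append_singleton u j _ =>
    refine ⟨wordProd u, j, wordProd_append_singleton u j, ?_⟩
    rw [wordProd_append_singleton] at *
    have h1 := length_wordProd_le u
    have h2 := height_wordProd_le u
    have h3 := length_mul_simple_le (wordProd u) j
    have h4 := height_signStep_le j (signVec (wordProd u)) rfl
    have h5 := height_le_length (wordProd u)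
    rw [← signVec_mul_simple] at h4
    simp only [List.length_append, List.length_singleton] at hu
    refine ⟨by omega, by omega, raises_of_height rfl ?_⟩
    rw [← signVec_mul_simple]
    omega

/-- Uniqueness of minimal representatives, by induction on length. If the last letters `i` and `j`
differ, both lower the same sign vector, so they commute, and the two elements are `u s_j s_i` and
`u s_i s_j` for a common `u`. -/
theorem eq_of_signVec_eq {v w : Grp n} (hv : length v = height (signVec v))
    (hw : length w = height (signVec w)) (h : signVec v = signVec w) : v = w := by
  induction hk : length v using Nat.strong_induction_on generalizing v w with
  | _ k ih =>
    subst hk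
    by_cases h0 : length v = 0
    · have h0' : length w = 0 := by rw [hw, ← h, ← hv, h0]
      obtain ⟨u, rfl, hu⟩ := exists_reduced v
      obtain ⟨u', rfl, hu'⟩ := exists_reduced w
      rw [h0, List.length_eq_zero_iff] at hu
      rw [h0', List.length_eq_zero_iff] at hu'
      rw [hu, hu']
    have h0' : length w ≠ 0 := by rwa [hw, ← h, ← hv]
    obtain ⟨v', i, rfl, hv', hlv, hri⟩ := exists_step hv h0
    obtain ⟨w', j, rfl, hw', hlw, hrj⟩ := exists_step hw h0'
    by_cases hij : i = j
    · subst hij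
      rw [signVec_mul_simple, signVec_mul_simple] at h
      have h2 : signVec v' = signVec w' := by
        rw [← signStep_signStep i (signVec v'), h, signStep_signStep]
      rw [ih _ (by omega) hv' hw' h2 rfl]
    have key : ∀ {v' w' : Grp n} {i j : Fin n}, i.val < j.val →
        length v' = height (signVec v') → length w' = height (signVec w') →
        signVec (v' * simple i) = signVec (w' * simple j) →
        Raises i (signVec v') → Raises j (signVec w') →
        (∀ m < length v' + 1, ∀ {x y : Grp n}, length x = height (signVec x) →
          length y = height (signVec y) → signVec x = signVec y → length x = m → x = y) →
        v' * simple i = w' * simple j := by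
      clear * -
      intro v w i j hlt hv hw h hri hrj ih
      rw [signVec_mul_simple, signVec_mul_simple] at h
      have hi : Raises i (signStep i (signStep i (signVec v))) := by rwa [signStep_signStep]
      have hj : Raises j (signStep j (signStep i (signVec v))) := by rwa [h, signStep_signStep]
      have s0 : signStep i (signVec v) 0 = true := by rw [signStep_zero]; rfl
      rw [lowers_iff _ _ s0] at hi hj
      -- If `i` and `j` were adjacent, the position they share would have to be `∧` to be lowered by
      -- `i` and `∨` to be lowered by `j`.
      have hlt' : i.val + 1 < j.val := by
        by_contra hcon
        have e : j.castSucc = i.succ := by ext; simp; omega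
        rcases hj.1 with h1 | h1
        · omega
        · rw [e, hi.2] at h1; exact absurd h1 (by simp)
      have hvw : height (signVec v) = height (signVec w) := by
        have e1 := height_signStep_of_raises hri
        have e2 := height_signStep_of_raises hrj
        rw [h] at e1; omega
      have hjv : Raises j (signStep j (signVec v)) := by
        rw [lowers_iff _ _ rfl]
        have e1 : signStep i (signVec v) j.castSucc = signVec v j.castSucc :=
          signStep_apply_of_ne (by rw [Ne, Fin.ext_iff]; simp; omega)
            (by rw [Ne, Fin.ext_iff]; simp; omega)
        have e2 : signStep i (signVec v) j.succ = signVec v j.succ :=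
          signStep_apply_of_ne (by rw [Ne, Fin.ext_iff]; simp; omega)
            (by rw [Ne, Fin.ext_iff]; simp; omega)
        rwa [e1, e2] at hj
      obtain ⟨u, hu1, hu2⟩ := exists_word (s := signStep j (signVec v)) (by rw [signStep_zero]; rfl)
      have hx := height_signStep_of_raises' hjv
      have g1 : wordProd u * simple j = v := by
        have e1 : signVec (wordProd u * simple j) = signVec v := by
          rw [signVec_mul_simple, hu2, signStep_signStep]
        have e2 := length_wordProd_le u
        have e3 := length_mul_simple_le (wordProd u) j
        have e4 := height_le_length (wordProd u * simple j)
        rw [e1] at e4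
        refine ih _ (Nat.lt_succ_self _) ?_ hv e1 ?_
        · rw [e1]; omega
        · omega
      have g2 : wordProd u * simple i = w := by
        have e1 : signVec (wordProd u * simple i) = signVec w := by
          rw [← signStep_signStep j (signVec w), ← h, ← g1, ← signVec_mul_simple,
            ← signVec_mul_simple, mul_assoc, mul_assoc, simple_comm hlt', ← mul_assoc (simple j), simple_mul_simple, one_mul]
        have e2 := length_wordProd_le u
        have e3 := length_mul_simple_le (wordProd u) i
        have e4 := height_le_length (wordProd u * simple i)
        rw [e1] at e4
        refine ih _ (Nat.lt_succ_self _) ?_ hw e1 ?_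
        · rw [e1]; omega
        · omega
      rw [← g1, ← g2, mul_assoc, mul_assoc, simple_comm hlt']
    rcases lt_or_gt_of_ne (fun e => hij (Fin.ext e) : i.val ≠ j.val) with hlt | hlt
    · exact key hlt hv' hw' h hri hrj fun m hm x y h1 h2 h3 h4 =>
        ih m (by omega) h1 h2 h3 h4
    · refine (key hlt hw' hv' h.symm hrj hri fun m hm x y h1 h2 h3 h4 =>
        ih m ?_ h1 h2 h3 h4).symm
      have := congrArg height h
      rw [signVec_mul_simple, signVec_mul_simple, height_signStep_of_raises hri,
        height_signStep_of_raises hrj] at this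
      omega

end group

/-! ### Edges of the extended Bruhat graph -/

section edges

variable {n : ℕ}

theorem Coset.length_eq (lam : Coset n) : length lam.1 = height (signVec lam.1) :=
  (isMin_iff lam.1).1 lam.2

theorem Coset.ext_signVec {lam mu : Coset n} (h : signVec lam.1 = signVec mu.1) : lam = mu :=
  Subtype.ext (eq_of_signVec_eq lam.length_eq mu.length_eq h)

theorem exists_coset {s : Fin (n + 1) → Bool} (h0 : s 0 = true) :
    ∃ lam : Coset n, signVec lam.1 = s := by
  obtain ⟨u, h1, h2⟩ := exists_word h0
  refine ⟨⟨wordProd u, (isMin_iff _).2 ?_⟩, h2⟩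
  have e1 := length_wordProd_le u
  have e2 := height_le_length (wordProd u)
  rw [h2] at *
  omega

/-- When `j` raises the signs, length and height both grow by one. When it lowers them, the minimal
`mu` with the lowered signs satisfies `mu s_j = lam` by uniqueness. -/
theorem exists_coset_mul_simple (lam : Coset n) (j : Fin n)
    (h : signStep j (signVec lam.1) ≠ signVec lam.1) :
    ∃ mu : Coset n, mu.1 = lam.1 * simple j := by
  obtain ⟨mu, hmu⟩ := exists_coset (s := signStep j (signVec lam.1)) (by rw [signStep_zero]; rfl)
  rcases raises_trichotomy j (signVec lam.1) rfl with h' | h' | h'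
  · refine ⟨⟨lam.1 * simple j, (isMin_iff _).2 ?_⟩, rfl⟩
    have e1 := length_mul_simple_le lam.1 j
    have e2 := height_le_length (lam.1 * simple j)
    have e3 := lam.length_eq
    rw [signVec_mul_simple, height_signStep_of_raises h'] at *
    omega
  · refine ⟨mu, ?_⟩
    have e0 : signVec (mu.1 * simple j) = signVec lam.1 := by
      rw [signVec_mul_simple, hmu, signStep_signStep]
    have e1 := length_mul_simple_le mu.1 j
    have e2 := height_le_length (mu.1 * simple j)
    have e3 := mu.length_eq
    have e4 := height_signStep_of_raises' h'
    have : mu.1 * simple j = lam.1 := by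
      apply eq_of_signVec_eq _ lam.length_eq e0
      rw [hmu] at e3
      rw [e0] at *
      omega
    rw [← this, mul_assoc, simple_mul_simple, mul_one]
  · exact absurd h'.1 h

theorem BruhatLT.length_lt {y w : Grp n} (h : BruhatLT y w) : length y < length w := by
  obtain ⟨⟨u, v, ⟨rfl, hu⟩, ⟨rfl, hv⟩, hs⟩, hne⟩ := h
  have := hs.length_le
  rcases this.lt_or_eq with e | e
  · omega
  · exact absurd (by rw [hs.eq_of_length e]) hne

theorem bruhatLT_of_raises {lam mu : Coset n} {j : Fin n} (h : mu.1 = lam.1 * simple j)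
    (hj : Raises j (signVec lam.1)) : BruhatLT lam.1 mu.1 := by
  have e1 := height_signStep_of_raises hj
  rw [← signVec_mul_simple, ← h, ← mu.length_eq, ← lam.length_eq] at e1
  obtain ⟨u, hu, hl⟩ := exists_reduced lam.1
  refine ⟨⟨u ++ [j], u, ⟨?_, ?_⟩, ⟨hu, hl⟩, List.sublist_append_left _ _⟩, ?_⟩
  · rw [wordProd_append_singleton, hu, h]
  · rw [e1, ← hl]; simp
  · intro e; rw [e] at e1; omega

/-- Bruhat comparability forces an inequality of lengths. For minimal representatives these are
heights, which detect the direction of the step. -/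
theorem bruhatLT_iff_raises {lam mu : Coset n} {j : Fin n} (h : mu.1 = lam.1 * simple j) :
    BruhatLT lam.1 mu.1 ↔ Raises j (signVec lam.1) := by
  refine ⟨fun e => ?_, bruhatLT_of_raises h⟩
  have := e.length_lt
  rw [mu.length_eq, lam.length_eq, h, signVec_mul_simple] at this
  rcases raises_trichotomy j (signVec lam.1) rfl with h' | h' | h'
  · exact h'
  · have := height_signStep_of_raises' h'; omega
  · rw [h'.1] at this; omega

open Classical in
/-- The contribution of a step of a path. -/
noncomputable def edgeWeight (lam : Coset n) (j : Fin n) (lam' : Coset n) : ℤ[T;T⁻¹] :=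
  if IsEdge lam j lam' then LaurentPolynomial.T (edgeDeg lam j lam') else 0

theorem IsEdge.signStep_ne {lam lam' : Coset n} {j : Fin n} (h : IsEdge lam j lam') :
    signStep j (signVec lam'.1) ≠ signVec lam'.1 := by
  obtain ⟨mu, hmu, hlt, h'⟩ := h
  intro e
  have hne : lam ≠ mu := by
    rintro rfl
    rcases hlt with hlt | hlt <;> exact hlt.2 rfl
  rcases h' with rfl | rfl
  · apply hne
    apply Coset.ext_signVec
    rw [hmu, signVec_mul_simple, e]
  · apply hne
    apply Coset.ext_signVec
    rw [← e, ← signVec_mul_simple, hmu, mul_assoc, simple_mul_simple, mul_one]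

theorem isEdge_iff {lam lam' mu : Coset n} {j : Fin n} (hmu : mu.1 = lam.1 * simple j)
    (hne : signStep j (signVec lam.1) ≠ signVec lam.1) :
    IsEdge lam' j lam ↔ lam' = lam ∨ lam' = mu := by
  have hmu' : lam.1 = mu.1 * simple j := by rw [hmu, mul_assoc, simple_mul_simple, mul_one]
  have hb : BruhatLT lam.1 mu.1 ∨ BruhatLT mu.1 lam.1 := by
    rcases raises_trichotomy j (signVec lam.1) rfl with h' | h' | h'
    · exact Or.inl (bruhatLT_of_raises hmu h')
    · rw [← signVec_mul_simple, ← hmu] at h'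
      exact Or.inr (bruhatLT_of_raises hmu' h')
    · exact absurd h'.1 hne
  constructor
  · rintro ⟨nu, hnu, -, h | h⟩
    · exact Or.inl h.symm
    · right
      apply Subtype.ext
      rw [hmu, h, hnu, mul_assoc, simple_mul_simple, mul_one]
  · rintro (rfl | rfl)
    · exact ⟨mu, hmu, hb, Or.inl rfl⟩
    · exact ⟨lam, hmu', hb.symm, Or.inr rfl⟩

theorem sum_edgeWeight_of_fixed (f : Coset n → ℤ[T;T⁻¹]) (lam : Coset n) (j : Fin n)
    (h : signStep j (signVec lam.1) = signVec lam.1) :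
    ∑ nu, f nu * edgeWeight nu j lam = 0 := by
  apply Finset.sum_eq_zero
  intro nu _
  rw [edgeWeight, if_neg, mul_zero]
  intro e
  exact e.signStep_ne h

-- Exactly two edges with label `j` end at `lam`: the one from `mu`, of degree 0, and the loop,
-- whose degree depends on whether `lam` is the lower or the upper vertex.
open Classical in
theorem sum_edgeWeight (f : Coset n → ℤ[T;T⁻¹]) {lam mu : Coset n} (j : Fin n)
    (hmu : mu.1 = lam.1 * simple j) (hne : signStep j (signVec lam.1) ≠ signVec lam.1) :
    ∑ nu, f nu * edgeWeight nu j lam =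
      f mu + LaurentPolynomial.T (if Raises j (signVec lam.1) then 1 else -1) * f lam := by
  have hlm : lam ≠ mu := by
    rintro rfl
    apply hne
    rw [← signVec_mul_simple, ← hmu]
  have hmu' : lam.1 = mu.1 * simple j := by rw [hmu, mul_assoc, simple_mul_simple, mul_one]
  rw [Finset.sum_eq_add_of_mem mu lam (Finset.mem_univ _) (Finset.mem_univ _) hlm.symm]
  · rw [edgeWeight, edgeWeight, if_pos ((isEdge_iff hmu hne).2 (Or.inr rfl)),
      if_pos ((isEdge_iff hmu hne).2 (Or.inl rfl)), edgeDeg, edgeDeg, if_pos hmu', if_neg,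
      ← hmu]
    · simp only [bruhatLT_iff_raises hmu, LaurentPolynomial.T_zero, mul_one]
      rw [mul_comm (f lam)]
    · rw [← hmu]
      exact fun e => hlm (Subtype.ext e)
  · intro nu _ h
    rw [edgeWeight, if_neg, mul_zero]
    rw [isEdge_iff hmu hne]
    tauto

end edges

/-! ### Sums over paths -/

section paths

variable {n : ℕ}

open Classical in
/-- The sum of the weights of the paths from `∅` to `lam` with labels `l`. -/
noncomputable def pathSum {k : ℕ} (l : Fin k → Fin n) (lam : Coset n) : ℤ[T;T⁻¹] :=
  ∑ v : Fin (k + 1) → Coset n,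
    if v 0 = emptyCoset n ∧ v (Fin.last k) = lam then
      ∏ j : Fin k, edgeWeight (v j.castSucc) (l j) (v j.succ) else 0

theorem T_sum {ι : Type*} (s : Finset ι) (f : ι → ℤ) :
    (LaurentPolynomial.T (∑ i ∈ s, f i) : ℤ[T;T⁻¹]) = ∏ i ∈ s, LaurentPolynomial.T (f i) := by
  classical
  induction s using Finset.induction_on with
  | empty => simp
  | insert a s ha ih => rw [Finset.sum_insert ha, Finset.prod_insert ha, LaurentPolynomial.T_add, ih]

/-- Paths with given labels and end point are given by their vertices. -/
def pathsEquiv {k : ℕ} (l : Fin k → Fin n) (lam : Coset n) :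
    {S : BruhatPath n k // S.shape = lam ∧ S.label = l} ≃
    {v : Fin (k + 1) → Coset n // v 0 = emptyCoset n ∧ v (Fin.last k) = lam ∧
      ∀ j : Fin k, IsEdge (v j.castSucc) (l j) (v j.succ)} where
  toFun S := ⟨S.1.vertex, S.1.start, S.2.1, fun j => (congrFun S.2.2 j) ▸ S.1.edge j⟩
  invFun v := ⟨⟨v.1, l, v.2.1, v.2.2.2⟩, v.2.2.1, rfl⟩
  left_inv := by
    rintro ⟨S, h1, rfl⟩
    rfl
  right_inv _ := rfl

/-- Summing over all vertex sequences is harmless because `edgeWeight` vanishes off the graph. This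
turns the path sum into a product of transfer matrices. -/
theorem lightLeaves_apply (R : ReducedPaths n) (lam mu : Coset n) :
    lightLeaves R lam mu = pathSum (R.path mu).label lam := by
  classical
  unfold lightLeaves pathSum
  rw [Matrix.of_apply, Fintype.sum_equiv (pathsEquiv (R.path mu).label lam) _
    (fun v => ∏ j, edgeWeight (v.1 j.castSucc) ((R.path mu).label j) (v.1 j.succ))]
  · rw [← Finset.sum_subtype (Finset.univ.filter fun v : Fin (R.len mu + 1) → Coset n =>
        v 0 = emptyCoset n ∧ v (Fin.last _) = lam ∧
        ∀ j, IsEdge (v j.castSucc) ((R.path mu).label j) (v j.succ)) (by simp)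
      (fun v => ∏ j, edgeWeight (v j.castSucc) ((R.path mu).label j) (v j.succ)),
      Finset.sum_filter]
    apply Finset.sum_congr rfl
    intro v _
    by_cases h : ∀ j, IsEdge (v j.castSucc) ((R.path mu).label j) (v j.succ)
    · simp only [h, implies_true, and_true]
    · rw [if_neg (fun e => h e.2.2)]
      push Not at h
      obtain ⟨j, hj⟩ := h
      rw [Finset.prod_eq_zero (Finset.mem_univ j) (by rw [edgeWeight, if_neg hj])]
      simp
  · rintro ⟨S, h1, h2⟩
    unfold BruhatPath.deg
    rw [T_sum]
    apply Finset.prod_congr rfl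
    intro j _
    have e : edgeWeight (S.vertex j.castSucc) (S.label j) (S.vertex j.succ) =
        LaurentPolynomial.T (edgeDeg (S.vertex j.castSucc) (S.label j) (S.vertex j.succ)) :=
      if_pos (S.edge j)
    exact e.symm.trans (by rw [congrFun h2 j]; rfl)

theorem pathSum_zero (l : Fin 0 → Fin n) (lam : Coset n) [Decidable (lam = emptyCoset n)] :
    pathSum l lam = if lam = emptyCoset n then 1 else 0 := by
  classical
  unfold pathSum
  rw [Fintype.sum_equiv (Equiv.funUnique (Fin 1) (Coset n)) _
    (fun nu => if nu = emptyCoset n ∧ nu = lam then 1 else 0)]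
  · by_cases h : lam = emptyCoset n
    · subst h; simp
    · rw [if_neg h]
      apply Finset.sum_eq_zero
      intro nu _
      rw [if_neg]
      rintro ⟨rfl, rfl⟩
      exact h rfl
  · intro v
    simp

theorem pathSum_succ {k : ℕ} (l : Fin (k + 1) → Fin n) (lam : Coset n) :
    pathSum l lam = ∑ nu, pathSum (fun j => l j.castSucc) nu * edgeWeight nu (l (Fin.last k)) lam := by
  classical
  unfold pathSum
  rw [← (Fin.snocEquiv fun _ : Fin (k + 2) => Coset n).sum_comp, Fintype.sum_prod_type,
    Finset.sum_comm]
  simp only [Finset.sum_mul]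
  rw [Finset.sum_comm (γ := Coset n)]
  apply Finset.sum_congr rfl
  intro v _
  have e0 : ∀ x : Coset n, Fin.snoc (α := fun _ => Coset n) v x 0 = v 0 := fun x => by
    rw [← Fin.castSucc_zero, Fin.snoc_castSucc]
  -- The last vertex must be `lam`, and the summation index `nu` must be the end point of the
  -- truncated sequence.
  rw [Finset.sum_eq_single lam (fun x _ h => by simp [h]) (by simp),
    Finset.sum_eq_single (v (Fin.last k)) (fun nu _ h => by simp [h.symm]) (by simp)]
  simp only [Fin.snocEquiv_apply, e0, Fin.snoc_last, and_true, Fin.prod_univ_castSucc,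
    Fin.snoc_castSucc, Fin.succ_last, ← Fin.castSucc_succ, ite_mul, zero_mul]

end paths

/-! ### The northern half of a tangle -/

section north

variable {n : ℕ}

/-- The northern vertex joined to the northern vertex `x`, or `x` if there is none. -/
def northPartner {m : ℕ} (d : Tangle m) (x : Fin m) : Fin m :=
  match d.partner (.north x) with
  | .north y => y
  | .south _ => x

/-- The beads at the northern vertices, where the vertex at position `0` always counts as beaded. -/
def northBead (d : Tangle (n + 1)) (x : Fin (n + 1)) : Bool :=
  d.bead (.north x) || decide (x = 0)

theorem northPartner_cases {m : ℕ} (d : Tangle m) (x : Fin m) :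
    (d.partner (.north x) = .north (northPartner d x) ∧ northPartner d x ≠ x) ∨
    ((∃ y, d.partner (.north x) = .south y) ∧ northPartner d x = x) := by
  unfold northPartner
  rcases h : d.partner (.north x) with y | y
  · left
    refine ⟨rfl, ?_⟩
    intro e
    change y = x at e
    rw [e] at h
    exact d.partner_ne _ h
  · right
    exact ⟨⟨y, rfl⟩, rfl⟩

theorem northPartner_eq_of_north {m : ℕ} {d : Tangle m} {x y : Fin m}
    (h : d.partner (.north x) = .north y) : northPartner d x = y := by
  unfold northPartner; rw [h]

theorem northPartner_eq_of_south {m : ℕ} {d : Tangle m} {x y : Fin m}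
    (h : d.partner (.north x) = .south y) : northPartner d x = x := by
  unfold northPartner; rw [h]

theorem partner_north_eq_iff {m : ℕ} (d : Tangle m) {x y : Fin m} (h : x ≠ y) :
    d.partner (.north x) = .north y ↔ northPartner d x = y := by
  refine ⟨northPartner_eq_of_north, fun e => ?_⟩
  rcases northPartner_cases d x with h1 | h1
  · rw [h1.1, e]
  · exact absurd (h1.2.symm.trans e) h

/-- The properties of the diagrams `e_mu`, where `s` is the sign vector of `mu`. -/
structure Good (d : Tangle (n + 1)) (s : Fin (n + 1) → Bool) : Prop where
  loops : d.loops = 0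
  south : ∀ i j, d.partner (.south i) = .south j → d.bead (.south i) = true
  corner : d = Tangle.one (n + 1) ∨ ((∃ k, d.partner (.south 0) = .south k) ∧
    d.bead (.north 0) = true ∧ d.bead (.south 0) = true)
  shape : HasShape (northPartner d) (northBead d) s

theorem Good.bead_zero {d : Tangle (n + 1)} {s : Fin (n + 1) → Bool} (h : Good d s)
    {x : Fin (n + 1)} (hx : d.partner (.north 0) = .north x) : d.bead (.north 0) = true := by
  rcases h.corner with h1 | h1
  · rw [h1] at hx
    simp [Tangle.one] at hx
  · exact h1.2.1

/-- The bead imposed at position 0 must also appear at its partner. A northern arc at 0 excludes the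
identity tangle, and then the bead is genuine. -/
theorem Good.northBead_partner {d : Tangle (n + 1)} {s : Fin (n + 1) → Bool} (h : Good d s)
    (x : Fin (n + 1)) : northBead d (northPartner d x) = northBead d x := by
  rcases northPartner_cases d x with ⟨h1, h2⟩ | ⟨h1, h2⟩
  · have b := d.bead_partner (.north x)
    rw [h1] at b
    have h3 : d.partner (.north (northPartner d x)) = .north x := by rw [← h1, d.partner_partner]
    unfold northBead
    by_cases e : x = 0
    · subst e
      rw [b, h.bead_zero h1]; simp
    · by_cases e' : northPartner d x = 0
      · rw [e'] at b h3 ⊢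
        rw [← b, h.bead_zero h3]; simp
      · simp [e, e', b]
  · rw [h2]

theorem Good.isCap {d : Tangle (n + 1)} {s : Fin (n + 1) → Bool} (h : Good d s) :
    IsCap (northPartner d) (northBead d) where
  invol x := by
    rcases northPartner_cases d x with ⟨h1, h2⟩ | ⟨h1, h2⟩
    · apply northPartner_eq_of_north
      rw [← h1, d.partner_partner]
    · rw [h2, h2]
  bead := h.northBead_partner
  noncrossing x y h1 h2 := by
    rcases northPartner_cases d x with ⟨e1, e2⟩ | ⟨e1, e2⟩
    · have nb := d.between_iff (.north x) (.north y) (by simp [h1.ne']) (by rw [e1]; simp [h2.ne])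
      rw [e1] at nb
      rcases northPartner_cases d y with ⟨e3, e4⟩ | ⟨⟨z, e3⟩, e4⟩
      · rw [e3] at nb
        simp only [Vertex.pos, Fin.lt_def] at *
        omega
      · rw [e4]; exact ⟨h1, h2⟩
    · rw [e2] at h2; exact absurd h2 h1.not_gt
  through x y h1 h2 e := by
    rcases northPartner_cases d x with ⟨e1, e2⟩ | ⟨e1, e2⟩
    · rcases northPartner_cases d y with ⟨e3, e4⟩ | ⟨⟨z, e3⟩, e4⟩
      · exact e4 e
      · have nc := d.noncrossing (.north x) (.north y)
        rw [e1, e3] at nc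
        simp only [Vertex.pos, Fin.lt_def] at *
        have := (northPartner d x).isLt
        omega
    · rw [e2] at h2; exact absurd h2 h1.not_gt
  exposed x y h1 h2 := by
    rcases northPartner_cases d x with ⟨e1, e2⟩ | ⟨e1, e2⟩
    · have nb := d.between_iff (.north x) (.north y) (by simp [h1.ne']) (by rw [e1]; simp [h2.ne])
      have le := d.leftExposed (.north y)
      have le := fun e => le e (.north x)
      rw [e1] at nb le
      by_contra hb
      rw [Bool.not_eq_false] at hb
      unfold northBead at hb
      have hy : y ≠ 0 := by rintro rfl; exact absurd h1 (Fin.not_lt_zero x)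
      simp only [hy, decide_false, Bool.or_false] at hb
      have le := le hb
      simp only [Vertex.pos, Fin.lt_def] at *
      omega
    · rw [e2] at h2; exact absurd h2 h1.not_gt
  left x y h1 h2 := by
    by_contra hlt
    rw [not_le] at hlt
    have hy : y ≠ 0 := by rintro rfl; exact absurd hlt (Fin.not_lt_zero x)
    simp only [northBead, hy, decide_false, Bool.or_false] at h2
    rcases northPartner_cases d x with ⟨e1, e2⟩ | ⟨⟨z, e1⟩, e2⟩
    · exact e2 h1
    · have le := d.leftExposed (.north y) h2 (.north x)
      have nc := d.noncrossing (.north x) (.north y)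
      have nc' := d.noncrossing (d.partner (.north y)) (.north x)
      rw [d.partner_partner] at nc'
      have hz := z.isLt
      rcases e3 : d.partner (.north y) with w | w <;> rw [e3] at le nc nc' <;>
        rw [e1] at le nc <;> have hw := w.isLt
      · have : w ≠ x := by
          rintro rfl
          have := congrArg d.partner e3
          rw [d.partner_partner, e1] at this
          simp at this
        rw [Ne, Fin.ext_iff] at this
        rw [e1] at nc'
        simp only [Vertex.pos, Fin.lt_def] at le nc nc' hlt
        omega
      · have : w ≠ z := by
          rintro rfl
          have := congrArg d.partner e3
          rw [d.partner_partner, ← e1, d.partner_partner] at this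
          exact hlt.ne' (Vertex.north.inj this)
        rw [Ne, Fin.ext_iff] at this
        simp only [Vertex.pos, Fin.lt_def] at le nc hlt
        omega

theorem northPartner_topMul (d : Tangle (n + 1)) (j : Fin n) :
    northPartner (topMul d j) = capPartner (northPartner d) j.castSucc j.succ := by
  have hne : j.castSucc ≠ j.succ := Fin.castSucc_lt_succ.ne
  funext x
  have hp : (topMul d j).partner (.north x) = d.stackPartner j.castSucc j.succ (.north x) := rfl
  unfold Tangle.stackPartner at hp
  simp only [Vertex.north.injEq] at hp
  unfold capPartner
  by_cases h1 : x = j.castSucc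
  · rw [if_pos h1] at hp ⊢
    exact northPartner_eq_of_north hp
  by_cases h2 : x = j.succ
  · rw [if_neg h1, if_pos h2] at hp ⊢
    exact northPartner_eq_of_north hp
  rw [if_neg h1, if_neg h2] at hp ⊢
  simp only [partner_north_eq_iff d h1, partner_north_eq_iff d h2] at hp
  by_cases h3 : northPartner d x = j.castSucc
  · rw [if_pos h3] at hp ⊢
    rcases northPartner_cases d j.succ with ⟨e3, e4⟩ | ⟨⟨z, e3⟩, e4⟩
    · rw [if_neg e4]; rw [e3] at hp
      exact northPartner_eq_of_north hp
    · rw [if_pos e4]; rw [e3] at hp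
      exact northPartner_eq_of_south hp
  rw [if_neg h3] at hp ⊢
  by_cases h4 : northPartner d x = j.succ
  · rw [if_pos h4] at hp ⊢
    rcases northPartner_cases d j.castSucc with ⟨e3, e4⟩ | ⟨⟨z, e3⟩, e4⟩
    · rw [if_neg e4]; rw [e3] at hp
      exact northPartner_eq_of_north hp
    · rw [if_pos e4]; rw [e3] at hp
      exact northPartner_eq_of_south hp
  rw [if_neg h4] at hp ⊢
  rcases northPartner_cases d x with ⟨e3, e4⟩ | ⟨⟨z, e3⟩, e4⟩
  · rw [e3] at hp
    exact northPartner_eq_of_north hp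
  · rw [e4]; rw [e3] at hp
    exact northPartner_eq_of_south hp

theorem castSucc_eq_zero_iff (j : Fin n) : j.castSucc = 0 ↔ j.val = 0 := by
  rw [Fin.ext_iff]; rfl

theorem Good.northBead_topMul {d : Tangle (n + 1)} {s : Fin (n + 1) → Bool} (h : Good d s)
    (j : Fin n) :
    northBead (topMul d j) =
      capBead (northPartner d) (northBead d) j.castSucc j.succ (decide (j.val = 0)) := by
  have hs := Fin.succ_ne_zero j
  have hc := castSucc_eq_zero_iff j
  funext x
  have hp : (topMul d j).bead (.north x) =
    d.stackBead j.castSucc j.succ (decide (j.val = 0)) (.north x) := rfl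
  unfold Tangle.stackBead at hp
  simp only [Vertex.north.injEq] at hp
  unfold capBead
  rw [northBead, hp]
  by_cases h1 : x = j.castSucc ∨ x = j.succ
  · rw [if_pos h1, if_pos h1]
    rcases h1 with rfl | rfl
    · simp [hc]
    · simp
  rw [if_neg h1, if_neg h1]
  rw [not_or] at h1
  simp only [partner_north_eq_iff d h1.1, partner_north_eq_iff d h1.2]
  by_cases h2 : northPartner d x = j.castSucc ∨ northPartner d x = j.succ
  · rw [if_pos h2, if_pos h2]
    by_cases hx : x = 0
    · subst hx
      have b := h.northBead_partner 0
      have b0 : northBead d 0 = true := by simp [northBead]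
      rw [b0] at b
      rcases h2 with h2 | h2 <;> rw [h2] at b <;> rw [b] <;> simp
    · simp only [northBead, hx, hs, hc, decide_false, Bool.or_false]
      cases d.bead (.north j.castSucc) <;> cases d.bead (.north j.succ) <;>
        cases decide (j.val = 0) <;> rfl
  · rw [if_neg h2, if_neg h2]
    rfl

theorem northBead_zero (d : Tangle (n + 1)) : northBead d 0 = true := by
  simp [northBead]

theorem good_one : Good (Tangle.one (n + 1)) (signVec (1 : Grp n)) where
  loops := rfl
  south i j h := by simp [Tangle.one] at h
  corner := Or.inl rfl
  shape x := by
    have : northPartner (Tangle.one (n + 1)) x = x := northPartner_eq_of_south rfl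
    rw [this]
    refine Fin.cases ?_ (fun k => ?_) x
    · simp [northBead]
    · rw [signVec_one_succ]
      simp [northBead, Tangle.one]

/-- All invariants rest on one point: where the raised position is a through strand, the joined
strand receives a bead, either from that strand or from the generator. -/
theorem Good.topMul_of_raises {d : Tangle (n + 1)} {s : Fin (n + 1) → Bool} (h : Good d s) {j : Fin n}
    (hj : Raises j s) : Good (topMul d j) (signStep j s) := by
  obtain ⟨ha, hb⟩ := hj
  obtain ⟨f1, f2, f3, f4⟩ := h.shape.step_facts h.isCap (by simp) ha hb
  have hc := castSucc_eq_zero_iff j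
  have hne : j.castSucc ≠ j.succ := Fin.castSucc_lt_succ.ne
  -- An `∧` on a through strand comes from a bead. The bead that position 0 has by convention is
  -- supplied by `e_{1'}`.
  have hbead : northPartner d j.castSucc = j.castSucc →
      (d.bead (.north j.castSucc) || decide (j.val = 0)) = true := by
    intro e
    rw [e] at f3
    have := f3.resolve_right (lt_irrefl _)
    simpa [northBead, hc] using this
  refine ⟨?_, ?_, ?_, ?_⟩
  · have : d.partner (.north j.castSucc) ≠ .north j.succ := by
      rwa [Ne, partner_north_eq_iff d hne]
    exact (if_neg this).trans h.loops
  · intro i k hik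
    change d.stackPartner j.castSucc j.succ (.south i) = _ at hik
    change d.stackBead j.castSucc j.succ _ (.south i) = _
    rcases d.stackPartner_cases j.castSucc j.succ (decide (j.val = 0)) (by simp) (.south i) with
      e | e | e | e | e
    · exact absurd e.1 (by simp)
    · exact absurd e.1 (by simp)
    · rw [e.2.2.2.2.2, Bool.or_right_comm, hbead (northPartner_eq_of_south e.2.2.1)]
      rfl
    · rw [e.2.2.2.2.1] at hik
      rw [e.2.2.2.2.2, Bool.or_right_comm, hbead (northPartner_eq_of_south hik)]
      rfl
    · rw [e.2.2.2.2.2]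
      rw [e.2.2.2.2.1] at hik
      exact h.south i k hik
  · right
    rcases h.corner with h1 | ⟨⟨k, h1⟩, h2, h3⟩
    · have hj0 : j.val = 0 := by
        have hp : northPartner d j.castSucc = j.castSucc := by
          rw [h1]; exact northPartner_eq_of_south rfl
        have := hbead hp
        simpa [h1, Tangle.one] using this
      have hc0 := hc.2 hj0
      subst h1
      refine ⟨⟨j.succ, ?_⟩, ?_, ?_⟩
      · change Tangle.stackPartner _ j.castSucc j.succ (.south 0) = _
        rw [hc0]
        simp [Tangle.stackPartner, Tangle.one]
      · change Tangle.stackBead _ j.castSucc j.succ _ (.north 0) = _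
        simp [Tangle.stackBead, hc0, hj0]
      · change Tangle.stackBead _ j.castSucc j.succ _ (.south 0) = _
        simp [Tangle.stackBead, hc0, hj0, Tangle.one]
    · refine ⟨⟨k, ?_⟩, ?_, ?_⟩
      · change Tangle.stackPartner _ j.castSucc j.succ (.south 0) = _
        simp [Tangle.stackPartner, h1]
      · have h4 : northBead (topMul d j) 0 = true := northBead_zero _
        change Tangle.stackBead _ j.castSucc j.succ _ (.north 0) = _
        by_cases hj0 : j.val = 0
        · simp [Tangle.stackBead, hc.2 hj0, hj0]
        · have e1 : (0 : Fin (n + 1)) ≠ j.castSucc := fun e => hj0 (hc.1 e.symm)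
          have e2 : (0 : Fin (n + 1)) ≠ j.succ := (Fin.succ_ne_zero j).symm
          have b := d.bead_partner (.north 0)
          unfold Tangle.stackBead
          simp only [Vertex.north.injEq, e1, e2, or_self, if_false]
          split_ifs with h5
          · rw [h2] at b
            rcases h5 with h5 | h5 <;> rw [h5] at b <;> simp [b]
          · exact h2
      · change Tangle.stackBead _ j.castSucc j.succ _ (.south 0) = _
        simp [Tangle.stackBead, h1, h3]
  · rw [northPartner_topMul, h.northBead_topMul]
    refine h.shape.stack h.isCap (by simp) ha hb (fun x h1 h2 => signStep_apply_of_ne h1 h2) ?_ ?_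
      (fun _ => f3) ?_
    · by_cases hj0 : j.val = 0 <;> simp [signStep, hj0, ha, hb]
    · by_cases hj0 : j.val = 0 <;> simp [signStep, hj0, ha, hb, hne]
    · intro hj0
      rw [hc.2 (by simpa using hj0)]
      exact northBead_zero d

/-! ### Orientations in terms of the northern half -/

theorem diagram_eq_down_iff (lam : Coset n) (x : Fin (n + 1)) :
    diagram lam x = .down ↔ signVec lam.1 x = false := by
  refine Fin.cases ?_ (fun k => ?_) x
  · simp [diagram]
  · rw [signVec_succ]
    simp [diagram]

theorem diagram_eq_circ_iff (lam : Coset n) (x : Fin (n + 1)) :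
    diagram lam x = .circ ↔ x = 0 := by
  refine Fin.cases ?_ (fun k => ?_) x
  · simp [diagram]
  · simp [diagram, Fin.succ_ne_zero]
    split_ifs <;> simp

theorem diagram_emptyCoset_ne_up (x : Fin (n + 1)) : diagram (emptyCoset n) x ≠ .up := by
  refine Fin.cases ?_ (fun k => ?_) x
  · simp [diagram]
  · simp [diagram, emptyCoset]

theorem touchesCirc_north_iff (d : Tangle (n + 1)) (lam : Coset n) (x : Fin (n + 1)) :
    TouchesCirc d (diagram (emptyCoset n)) (diagram lam) (.north x) ↔
      x = 0 ∨ d.partner (.north x) = .north 0 ∨ d.partner (.north x) = .south 0 := by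
  unfold TouchesCirc
  rcases h : d.partner (.north x) with y | y <;> simp [symbolAt, diagram_eq_circ_iff]

/-- The southern `∘` lies on a southern arc unless the tangle is the identity, so a northern vertex
on a strand with `∘` is 0 or the partner of 0, and both count as beaded. -/
theorem Good.not_touchesCirc {d : Tangle (n + 1)} {s : Fin (n + 1) → Bool} (h : Good d s)
    (lam : Coset n) {x : Fin (n + 1)} (hx : northBead d x = false) :
    ¬ TouchesCirc d (diagram (emptyCoset n)) (diagram lam) (.north x) := by
  rw [touchesCirc_north_iff]
  rintro (rfl | e | e)
  · simp [northBead] at hx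
  · rw [← h.northBead_partner, northPartner_eq_of_north e, northBead_zero] at hx
    exact absurd hx (by simp)
  · rcases h.corner with h1 | ⟨⟨k, h1⟩, -⟩
    · rw [h1] at e
      simp only [Tangle.one, Vertex.south.injEq] at e
      simp [northBead, e] at hx
    · rw [← e, d.partner_partner] at h1
      exact absurd h1 (by simp)

theorem Good.inDTC {d : Tangle (n + 1)} {s : Fin (n + 1) → Bool} (h : Good d s) : InDTC d := by
  refine ⟨h.loops, ?_⟩
  rcases h.corner with h1 | ⟨⟨k, h1⟩, h2, h3⟩
  · left; rw [h1]; exact ⟨rfl, rfl⟩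
  · right; right
    refine ⟨fun e => ?_, h2, h3⟩
    rw [← e, d.partner_partner] at h1
    exact absurd h1 (by simp)

theorem pointsIn_north_iff (s : Fin (n + 1) → Arrow) (lam : Coset n) (x : Fin (n + 1)) :
    PointsIn s (diagram lam) (.north x) ↔ signVec lam.1 x = false :=
  diagram_eq_down_iff lam x

theorem not_pointsIn_south (t : Fin (n + 1) → Arrow) (x : Fin (n + 1)) :
    ¬ PointsIn (diagram (emptyCoset n)) t (.south x) :=
  diagram_emptyCoset_ne_up x

/-- No southern arrow points in, so an undecorated through strand is oriented exactly if its
northern end is `∨`. An undecorated southern arc would fail, but all southern arcs carry beads. -/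
theorem Good.inODT_iff {d : Tangle (n + 1)} {s : Fin (n + 1) → Bool} (h : Good d s)
    (lam : Coset n) :
    InODT (emptyCoset n) d lam ↔ CapOriented (northPartner d) (northBead d) (signVec lam.1) := by
  have hp := pointsIn_north_iff (diagram (emptyCoset n)) lam
  have hs := not_pointsIn_south (diagram lam)
  constructor
  · rintro ⟨-, o, -⟩ x hx
    have hb : d.bead (.north x) = false := by
      simp only [northBead, Bool.or_eq_false_iff] at hx; exact hx.1
    have ox := (o (.north x) hb).resolve_left (h.not_touchesCirc lam hx)
    rw [hp] at ox
    rcases northPartner_cases d x with ⟨e1, e2⟩ | ⟨⟨z, e1⟩, e2⟩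
    · refine ⟨fun e => absurd e e2, fun _ => ?_⟩
      rw [e1, hp] at ox
      cases h1 : signVec lam.1 x <;> cases h2 : signVec lam.1 (northPartner d x) <;>
        simp [h1, h2] at ox ⊢
    · refine ⟨fun _ => ?_, fun e => absurd e2 e⟩
      rw [e1] at ox
      exact ox.2 (hs z)
  · intro o
    refine ⟨h.inDTC, ?_, ?_⟩
    · have hnorth : ∀ x, d.bead (.north x) = false →
          StrandOriented d (diagram (emptyCoset n)) (diagram lam) (.north x) := by
        intro x hb
        by_cases hx : x = 0
        · left
          rw [touchesCirc_north_iff]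
          exact Or.inl hx
        right
        have ox := o x (by simp [northBead, hb, hx])
        rw [hp]
        rcases northPartner_cases d x with ⟨e1, e2⟩ | ⟨⟨z, e1⟩, e2⟩
        · have := ox.2 e2
          rw [e1, hp]
          cases h1 : signVec lam.1 x <;> cases h2 : signVec lam.1 (northPartner d x) <;>
            simp [h1, h2] at this ⊢
        · rw [e1]
          exact iff_of_true (ox.1 e2) (hs z)
      rintro (x | x) hb
      · exact hnorth x hb
      · rcases e : d.partner (.south x) with y | y
        · have e' : d.partner (.north y) = .south x := by rw [← e, d.partner_partner]
          have b := d.bead_partner (.south x)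
          rw [e, hb] at b
          rcases hnorth y b with h1 | h1
          · left
            unfold TouchesCirc at *
            rw [e, or_comm]
            rwa [e'] at h1
          · right
            rw [e, hp]
            rw [e', hp] at h1
            exact iff_of_false (hs x) (fun h2 => h2 (h1.2 (hs x)))
        · rw [h.south x y e] at hb
          exact absurd hb (by simp)
    -- The two symbols `∘` are joined only in the identity tangle, where nothing is decorated;
    -- otherwise the southern one lies on a southern arc.
    · intro x h1 h2
      rcases h.corner with h3 | ⟨⟨k, h3⟩, -⟩
      · rw [h3]; rfl
      · exfalso
        have h4 : ∀ y, symbolAt (diagram (emptyCoset n)) (diagram lam) y = .circ →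
            y = .north 0 ∨ y = .south 0 := by
          rintro (y | y) hy
          · left; rw [(diagram_eq_circ_iff _ _).1 hy]
          · right; rw [(diagram_eq_circ_iff _ _).1 hy]
        have h5 := d.partner_ne x
        have h6 := d.partner_ne (.south 0)
        have h7 := d.partner_partner x
        rcases h4 _ h1 with rfl | rfl <;> rcases h4 _ h2 with e | e
        · exact h5 e
        · rw [e, h3] at h7; exact absurd h7 (by simp)
        · rw [e] at h3; exact absurd h3 (by simp)
        · exact h5 e

/-- Southern arcs join two outgoing arrows and are flip-oriented automatically. A beaded through
strand away from `∘` is flip-oriented exactly if its northern end is `∧`. -/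
theorem Good.isStandard_iff {d : Tangle (n + 1)} {s : Fin (n + 1) → Bool} (h : Good d s)
    (lam : Coset n) :
    IsStandard (emptyCoset n) d lam ↔
      CapStandard (northPartner d) (northBead d) (signVec lam.1) := by
  have hp := pointsIn_north_iff (diagram (emptyCoset n)) lam
  have hs := not_pointsIn_south (diagram lam)
  constructor
  · intro o x hx
    have key : x ≠ 0 → (PointsIn (diagram (emptyCoset n)) (diagram lam) (.north x) ↔
        PointsIn (diagram (emptyCoset n)) (diagram lam) (d.partner (.north x))) ∨
        d.partner (.north x) = .north 0 := by
      intro hx0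
      rcases o (.north x) (by simpa [northBead, hx0] using hx) with h1 | h1
      · rw [touchesCirc_north_iff] at h1
        rcases h1 with h1 | h1 | h1
        · exact absurd h1 hx0
        · exact Or.inr h1
        · exfalso
          rcases h.corner with h2 | ⟨⟨k, h2⟩, -⟩
          · rw [h2] at h1
            simp only [Tangle.one, Vertex.south.injEq] at h1
            exact hx0 h1
          · rw [← h1, d.partner_partner] at h2
            exact absurd h2 (by simp)
      · exact Or.inl h1
    rcases northPartner_cases d x with ⟨e1, e2⟩ | ⟨⟨z, e1⟩, e2⟩
    · refine ⟨fun e => absurd e e2, fun _ hx0 hp0 => ?_⟩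
      have := key hx0
      rw [e1, hp, hp] at this
      rcases this with h1 | h1
      · cases h2 : signVec lam.1 x <;> cases h3 : signVec lam.1 (northPartner d x) <;>
          simp [h2, h3] at h1 ⊢
      · exact absurd (Vertex.north.inj h1) hp0
    · refine ⟨fun _ hx0 => ?_, fun e => absurd e2 e⟩
      have := key hx0
      rw [e1, hp] at this
      rcases this with h1 | h1
      · rw [← Bool.not_eq_false]
        exact fun e => hs z (h1.1 e)
      · exact absurd h1 (by simp)
  · intro o
    have hnorth : ∀ x, d.bead (.north x) = true →
        StrandFlipOriented d (diagram (emptyCoset n)) (diagram lam) (.north x) := by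
      intro x hb
      by_cases hx : x = 0
      · left
        rw [touchesCirc_north_iff]
        exact Or.inl hx
      have ox := o x (by simp [northBead, hb])
      rcases northPartner_cases d x with ⟨e1, e2⟩ | ⟨⟨z, e1⟩, e2⟩
      · by_cases hp0 : northPartner d x = 0
        · left
          rw [touchesCirc_north_iff, e1, hp0]
          simp
        · right
          rw [e1, hp, hp, ox.2 e2 hx hp0]
      · right
        rw [e1, hp, ox.1 e2 hx]
        exact iff_of_false (by simp) (hs z)
    rintro (x | x) hb
    · exact hnorth x hb
    · rcases e : d.partner (.south x) with y | y
      · have e' : d.partner (.north y) = .south x := by rw [← e, d.partner_partner]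
        have b := d.bead_partner (.south x)
        rw [e, hb] at b
        rcases hnorth y b with h1 | h1
        · left
          unfold TouchesCirc at *
          rw [e, or_comm]
          rwa [e'] at h1
        · right
          rw [e]
          rw [e'] at h1
          exact h1.symm
      · right
        rw [e]
        exact iff_of_false (hs x) (hs y)

theorem tangleDeg_eq_capDeg (d : Tangle (n + 1)) (lam : Coset n) :
    tangleDeg (emptyCoset n) d lam = capDeg (northPartner d) (signVec lam.1) := by
  have e1 : (Finset.univ.filter fun p : Fin (n + 1) × Fin (n + 1) =>
      p.1 < p.2 ∧ d.partner (.south p.1) = .south p.2 ∧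
        diagram (emptyCoset n) p.2 = .up) = ∅ := by
    apply Finset.filter_eq_empty_iff.2
    rintro p - ⟨-, -, h⟩
    exact diagram_emptyCoset_ne_up _ h
  have e2 : (Finset.univ.filter fun p : Fin (n + 1) × Fin (n + 1) =>
      p.1 < p.2 ∧ d.partner (.north p.1) = .north p.2 ∧ diagram lam p.2 = .down).card =
      (Finset.univ.filter fun y => northPartner d y < y ∧ signVec lam.1 y = false).card := by
    apply Finset.card_nbij' (fun p => p.2) (fun y => (northPartner d y, y))
    · rintro ⟨x, y⟩ h
      simp only [Finset.coe_filter, Finset.mem_univ, true_and, Set.mem_ofPred_eq] at h ⊢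
      have : d.partner (.north y) = .north x := by rw [← h.2.1, d.partner_partner]
      rw [northPartner_eq_of_north this, ← diagram_eq_down_iff]
      exact ⟨h.1, h.2.2⟩
    · intro y h
      simp only [Finset.coe_filter, Finset.mem_univ, true_and, Set.mem_ofPred_eq] at h ⊢
      refine ⟨h.1, ?_, (diagram_eq_down_iff _ _).2 h.2⟩
      have := (partner_north_eq_iff d h.1.ne').2 rfl
      rw [← this, d.partner_partner]
    · rintro ⟨x, y⟩ h
      simp only [Finset.coe_filter, Finset.mem_univ, true_and, Set.mem_ofPred_eq] at h ⊢
      have : d.partner (.north y) = .north x := by rw [← h.2.1, d.partner_partner]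
      rw [northPartner_eq_of_north this]
    · intro y _
      rfl
  unfold tangleDeg capDeg
  rw [e1, e2, Finset.card_filter]
  simp

end north

/-! ### Ascending words -/

section words

variable {n : ℕ}

/-- Each letter of the word `u` raises the sign vector of the product of the preceding letters. -/
def Ascending (u : List (Fin n)) : Prop :=
  u.length = height (signVec (wordProd u))

theorem Ascending.of_append_singleton {u : List (Fin n)} {j : Fin n} (h : Ascending (u ++ [j])) :
    Ascending u ∧ Raises j (signVec (wordProd u)) := by
  unfold Ascending at *
  rw [wordProd_append_singleton, signVec_mul_simple, List.length_append,
    List.length_singleton] at h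
  have h1 := height_signStep_le j (signVec (wordProd u)) rfl
  have h2 := height_wordProd_le u
  exact ⟨by omega, raises_of_height rfl (by omega)⟩

theorem tlProd_append_singleton (u : List (Fin n)) (j : Fin n) :
    tlProd (u ++ [j]) = topMul (tlProd u) j := by
  simp [tlProd]

theorem Ascending.good {u : List (Fin n)} (h : Ascending u) :
    Good (tlProd u) (signVec (wordProd u)) := by
  induction u using List.reverseRecOn with
  | nil => exact good_one
  | append_singleton u j ih =>
    obtain ⟨h1, h2⟩ := h.of_append_singleton
    rw [tlProd_append_singleton, wordProd_append_singleton, signVec_mul_simple]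
    exact (ih h1).topMul_of_raises h2

theorem IsReducedExpr.ascending {u : List (Fin n)} {mu : Coset n} (h : IsReducedExpr u mu.1) :
    Ascending u := by
  unfold Ascending
  rw [h.1, h.2, mu.length_eq]

/-! ### The light leaves matrix in terms of cap diagrams -/

/-- The weight of the signs `s` on the northern half of `d`. -/
noncomputable def northWeight (d : Tangle (n + 1)) (s : Fin (n + 1) → Bool) : ℤ[T;T⁻¹] :=
  capWeight (northPartner d) (northBead d) s

/-- The edge sum has the form required by `capWeight_stack`, with `t` the lower and `t'` the upper
of `lam` and `lam s_j`; the cases record which of them is `lam`. -/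
theorem Good.sum_northWeight {d : Tangle (n + 1)} {s : Fin (n + 1) → Bool} (h : Good d s)
    {j : Fin n} (hj : Raises j s) (lam : Coset n) :
    ∑ nu, northWeight d (signVec nu.1) * edgeWeight nu j lam =
      northWeight (topMul d j) (signVec lam.1) := by
  have hab : j.castSucc.val + 1 = j.succ.val := by simp
  obtain ⟨f1, f2, f3, f4⟩ := h.shape.step_facts h.isCap hab hj.1 hj.2
  have hc := castSucc_eq_zero_iff j
  have hne : j.castSucc ≠ j.succ := Fin.castSucc_lt_succ.ne
  -- Position 0 counts as beaded and is never a right end, which is the exceptional alternative of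
  -- `capWeight_stack`.
  have hzero : j.val = 0 → northBead d j.castSucc = true ∧
      ¬ northPartner d j.castSucc < j.castSucc := by
    intro e
    rw [hc.2 e]
    exact ⟨northBead_zero d, Fin.not_lt_zero _⟩
  have hc' : decide (j.val = 0) = true → northBead d j.castSucc = true :=
    fun e => (hzero (by simpa using e)).1
  unfold northWeight
  rw [northPartner_topMul, h.northBead_topMul]
  by_cases hfix : signStep j (signVec lam.1) = signVec lam.1
  · rw [sum_edgeWeight_of_fixed _ _ _ hfix]
    -- No edge with label `j` ends at `lam`, and on the diagram side the new unbeaded arc has equal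
    -- signs at its ends, so both sides vanish.
    rcases raises_trichotomy j (signVec lam.1) rfl with h' | h' | ⟨-, h1, h2⟩
    · have := height_signStep_of_raises h'
      rw [hfix] at this; omega
    · have := height_signStep_of_raises' h'
      rw [hfix] at this; omega
    · rw [decide_eq_false h1, capWeight_stack_eq_zero hab h2]
  obtain ⟨mu, hmu⟩ := exists_coset_mul_simple lam j hfix
  have hmus : signVec mu.1 = signStep j (signVec lam.1) := by rw [hmu, signVec_mul_simple]
  have hoff : ∀ x, x ≠ j.castSucc → x ≠ j.succ → signVec mu.1 x = signVec lam.1 x := by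
    intro x h1 h2
    rw [hmus, signStep_apply_of_ne h1 h2]
  rw [sum_edgeWeight _ j hmu hfix]
  by_cases hr : Raises j (signVec lam.1)
  · rw [capWeight_stack (t := signVec lam.1) (t' := signVec mu.1) h.isCap hab f1 f2 f3 f4 hc'
      (fun _ => by rw [hr.1, hr.2]; simp) (fun _ _ _ => rfl) hr.2 hr.1 hoff, if_pos hr,
      if_pos hr.2, mul_add, ← mul_assoc, ← LaurentPolynomial.T_add]
    · simp [add_comm]
    · rw [hmus]
      by_cases hj0 : j.val = 0 <;> simp [signStep, hj0, hr.1, hr.2]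
    · by_cases hj0 : j.val = 0
      · exact Or.inr (hzero hj0)
      · left
        rw [hmus]
        simp [signStep, hj0, hr.2]
  · have hl : Raises j (signStep j (signVec lam.1)) := by
      rcases raises_trichotomy j (signVec lam.1) rfl with h' | h' | h'
      · exact absurd h' hr
      · exact h'
      · exact absurd h'.1 hfix
    have hl' := (lowers_iff j _ rfl).1 hl
    rw [← hmus] at hl
    rw [capWeight_stack (t := signVec mu.1) (t' := signVec lam.1) h.isCap hab f1 f2 f3 f4 hc'
      _ hoff hl.2 hl.1 (fun _ _ _ => rfl) hl'.2, if_neg hr, hl'.2]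
    · simp
    · rcases hl'.1 with h1 | h1
      · exact Or.inr (hzero h1)
      · exact Or.inl h1
    · intro e
      rw [decide_eq_false_iff_not] at e
      rw [hl'.1.resolve_left e, hl'.2]
      simp

theorem northWeight_one (lam : Coset n) [Decidable (lam = emptyCoset n)] :
    northWeight (Tangle.one (n + 1)) (signVec lam.1) = if lam = emptyCoset n then 1 else 0 := by
  have hp : northPartner (Tangle.one (n + 1)) = id :=
    funext fun x => northPartner_eq_of_south rfl
  have ho : CapOriented (northPartner (Tangle.one (n + 1))) (northBead (Tangle.one (n + 1)))
      (signVec lam.1) ↔ lam = emptyCoset n := by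
    constructor
    · intro o
      apply Coset.ext_signVec
      funext x
      refine Fin.cases rfl (fun k => ?_) x
      rw [(o k.succ (by simp [northBead, Tangle.one])).1 (by rw [hp]; rfl)]
      exact (signVec_one_succ k).symm
    · rintro rfl x hx
      rw [hp]
      refine ⟨fun _ => ?_, fun e => absurd rfl e⟩
      revert hx
      refine Fin.cases ?_ (fun k _ => signVec_one_succ k) x
      intro hx
      simp [northBead] at hx
  unfold northWeight capWeight
  simp only [ho]
  split_ifs
  · rw [hp]
    simp [capDeg]
  · rfl

theorem pathSum_eq_northWeight {k : ℕ} (l : Fin k → Fin n) (h : Ascending (List.ofFn l))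
    (lam : Coset n) :
    pathSum l lam = northWeight (tlProd (List.ofFn l)) (signVec lam.1) := by
  classical
  induction k generalizing lam with
  | zero =>
    rw [pathSum_zero, List.ofFn_zero]
    exact (northWeight_one lam).symm
  | succ k ih =>
    rw [List.ofFn_succ', List.concat_eq_append] at h ⊢
    obtain ⟨h1, h2⟩ := h.of_append_singleton
    rw [pathSum_succ, tlProd_append_singleton, ← h1.good.sum_northWeight h2]
    simp only [ih _ h1]

/-! ### The labels of reduced paths -/

theorem exists_path {u : List (Fin n)} (h : Ascending u) :
    ∃ S : BruhatPath n u.length, S.shape.1 = wordProd u := by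
  suffices ∀ k, k = u.length → ∃ S : BruhatPath n k, S.shape.1 = wordProd u from this _ rfl
  induction u using List.reverseRecOn with
  | nil =>
    rintro k rfl
    exact ⟨⟨fun _ => emptyCoset n, Fin.elim0, rfl, fun j => j.elim0⟩, rfl⟩
  | append_singleton u j ih =>
    intro k hk
    rw [List.length_append, List.length_singleton] at hk
    subst hk
    obtain ⟨h1, h2⟩ := h.of_append_singleton
    obtain ⟨S, hS⟩ := ih h1 _ rfl
    have hne : signStep j (signVec S.shape.1) ≠ signVec S.shape.1 := by
      intro e
      rw [← hS] at h2
      have := height_signStep_of_raises h2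
      rw [e] at this
      omega
    obtain ⟨mu, hmu⟩ := exists_coset_mul_simple S.shape j hne
    rw [wordProd_append_singleton, ← hS, ← hmu]
    refine ⟨⟨Fin.snoc S.vertex mu, Fin.snoc S.label j, ?_, ?_⟩, ?_⟩
    · rw [← Fin.castSucc_zero, Fin.snoc_castSucc, S.start]
    · intro i
      refine Fin.lastCases ?_ (fun i => ?_) i
      · rw [Fin.snoc_castSucc, Fin.snoc_last, Fin.succ_last, Fin.snoc_last]
        rw [← hS] at h2
        exact ⟨mu, hmu, Or.inl (bruhatLT_of_raises hmu h2), Or.inr rfl⟩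
      · rw [Fin.snoc_castSucc, Fin.snoc_castSucc, ← Fin.castSucc_succ, Fin.snoc_castSucc]
        exact S.edge i
    · simp [BruhatPath.shape]

/-- Each edge raises the height by at most one. A path that attains the bound never stays in place,
so its labels spell its vertices. -/
theorem BruhatPath.height_vertex_le {k : ℕ} (S : BruhatPath n k) (i : Fin (k + 1)) :
    height (signVec (S.vertex i).1) ≤ i.val ∧
      (height (signVec (S.vertex i).1) = i.val →
        wordProd ((List.ofFn S.label).take i.val) = (S.vertex i).1) := by
  induction i using Fin.induction with
  | zero =>
    rw [S.start]
    exact ⟨height_signVec_one.le, fun _ => rfl⟩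
  | succ i ih =>
    obtain ⟨nu, hnu, -, h⟩ := S.edge i
    rw [Fin.val_castSucc] at ih
    rw [Fin.val_succ]
    rcases h with h | h
    · rw [h]
      exact ⟨by omega, fun e => by omega⟩
    · have hl := height_signStep_le (S.label i) (signVec (S.vertex i.castSucc).1) rfl
      rw [h, hnu, signVec_mul_simple]
      refine ⟨by omega, fun e => ?_⟩
      rw [← ih.2 (by omega), ← wordProd_append_singleton,
        ← List.take_concat_get' _ _ (by simp), List.getElem_ofFn]

/-- A reduced expression of `mu` gives a path with `length mu` steps, so a shortest path has no
more, and by the height bound no fewer. -/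
theorem ReducedPaths.label_ascending (R : ReducedPaths n) (mu : Coset n) :
    Ascending (List.ofFn (R.path mu).label) ∧ wordProd (List.ofFn (R.path mu).label) = mu.1 := by
  obtain ⟨u, hu⟩ := exists_reduced mu.1
  obtain ⟨S, hS⟩ := exists_path hu.ascending
  have h1 := R.reduced mu _ S (by rw [R.shape_eq]; exact Subtype.ext (hS.trans hu.1))
  rw [hu.2, mu.length_eq] at h1
  have h2 := (R.path mu).height_vertex_le (Fin.last _)
  have h3 : (R.path mu).vertex (Fin.last _) = mu := R.shape_eq mu
  rw [h3, Fin.val_last, List.take_of_length_le (by simp)] at h2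
  have h4 := h2.2 (by omega)
  refine ⟨?_, h4⟩
  unfold Ascending
  rw [h4, List.length_ofFn]
  omega

end words

/-! ### The factorisation -/

section factorisation

variable {n : ℕ} {r : Coset n → List (Fin n)}

/-- The labels of `R.path mu` and the word `r mu` may be different reduced expressions. Their
tangles have the same northern half because both have the sign vector of `mu` as their shape. -/
theorem lightLeaves_eq_northWeight (R : ReducedPaths n)
    (hr : ∀ mu : Coset n, IsReducedExpr (r mu) mu.1) (lam mu : Coset n) :
    lightLeaves R lam mu = northWeight (tlProd (r mu)) (signVec lam.1) := by
  obtain ⟨h1, h2⟩ := R.label_ascending mu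
  have g1 := h1.good
  have g2 := (hr mu).ascending.good
  rw [h2] at g1
  rw [(hr mu).1] at g2
  obtain ⟨e1, e2⟩ := g1.isCap.eq_of_hasShape g2.isCap g1.shape g2.shape
  rw [lightLeaves_apply, pathSum_eq_northWeight _ h1, northWeight, northWeight, e1, e2]

open Classical in
theorem matrixN_apply (hr : ∀ mu : Coset n, IsReducedExpr (r mu) mu.1) (lam mu : Coset n) :
    matrixN r lam mu =
      if CapOriented (northPartner (tlProd (r mu))) (northBead (tlProd (r mu))) (signVec lam.1) ∧
        CapStandard (northPartner (tlProd (r mu))) (northBead (tlProd (r mu))) (signVec lam.1) then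
      LaurentPolynomial.T (capDeg (northPartner (tlProd (r mu))) (signVec lam.1)) else 0 := by
  have g := (hr mu).ascending.good
  rw [← tangleDeg_eq_capDeg, ← g.inODT_iff, ← g.isStandard_iff]
  rfl

open Classical in
theorem matrixB_apply (hr : ∀ mu : Coset n, IsReducedExpr (r mu) mu.1) (lam mu : Coset n) :
    matrixB r lam mu =
      if CapOriented (northPartner (tlProd (r mu))) (northBead (tlProd (r mu))) (signVec lam.1) ∧
        capDeg (northPartner (tlProd (r mu))) (signVec lam.1) = 0 then 1 else 0 := by
  have g := (hr mu).ascending.good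
  rw [← tangleDeg_eq_capDeg, ← g.inODT_iff]
  rfl

theorem northHalf_eq_restrictBead (hr : ∀ mu : Coset n, IsReducedExpr (r mu) mu.1)
    {nu mu : Coset n}
    (ho : CapOriented (northPartner (tlProd (r mu))) (northBead (tlProd (r mu))) (signVec nu.1))
    (h0 : capDeg (northPartner (tlProd (r mu))) (signVec nu.1) = 0) :
    northPartner (tlProd (r nu)) = northPartner (tlProd (r mu)) ∧
    northBead (tlProd (r nu)) =
      restrictBead (northPartner (tlProd (r mu))) (northBead (tlProd (r mu))) (signVec nu.1) := by
  have g := (hr mu).ascending.good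
  have g' := (hr nu).ascending.good
  rw [(hr nu).1] at g'
  exact g'.isCap.eq_of_hasShape (g.isCap.restrictBead _) g'.shape
    (hasShape_restrictBead g.isCap ho h0)

/-- By `key`, a nonzero summand forces `lam` to orient the undecorated strands of `e_mu` and `nu` to
be the coset with signs `middleSign`. Conversely, that coset contributes the weight of `lam` itself.
-/
theorem northWeight_eq_sum (hr : ∀ mu : Coset n, IsReducedExpr (r mu) mu.1) (lam mu : Coset n) :
    northWeight (tlProd (r mu)) (signVec lam.1) = ∑ nu, matrixN r lam nu * matrixB r nu mu := by
  classical
  have g := (hr mu).ascending.good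
  have key : ∀ nu, matrixN r lam nu * matrixB r nu mu ≠ 0 →
      CapOriented (northPartner (tlProd (r mu))) (northBead (tlProd (r mu))) (signVec lam.1) ∧
      signVec nu.1 = middleSign (northPartner (tlProd (r mu))) (signVec lam.1) := by
    intro nu h
    have hN := left_ne_zero_of_mul h
    have hB := right_ne_zero_of_mul h
    rw [matrixB_apply hr, ne_eq, ite_eq_right_iff, Classical.not_imp] at hB
    rw [matrixN_apply hr, ne_eq, ite_eq_right_iff, Classical.not_imp] at hN
    obtain ⟨⟨ho, h0⟩, -⟩ := hB
    obtain ⟨⟨ho', hs'⟩, -⟩ := hN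
    obtain ⟨e1, e2⟩ := northHalf_eq_restrictBead hr ho h0
    rw [e1, e2] at ho' hs'
    refine ⟨fun x hx => ho' x (by simp [restrictBead, hx]), ?_⟩
    exact eq_middleSign (hasShape_restrictBead g.isCap ho h0) rfl ho' hs'
  by_cases ho : CapOriented (northPartner (tlProd (r mu))) (northBead (tlProd (r mu)))
      (signVec lam.1)
  · obtain ⟨nu, hnu⟩ := exists_coset
      (s := middleSign (northPartner (tlProd (r mu))) (signVec lam.1)) (by simp [middleSign])
    have ho' := capOriented_middleSign g.isCap (northBead_zero _) ho
    have h0' := capDeg_middleSign (p := northPartner (tlProd (r mu))) (s := signVec lam.1)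
    rw [← hnu] at ho' h0'
    obtain ⟨e1, e2⟩ := northHalf_eq_restrictBead hr ho' h0'
    rw [Finset.sum_eq_single nu]
    · rw [matrixB_apply hr, if_pos ⟨ho', h0'⟩, mul_one, matrixN_apply hr, e1, e2, hnu, if_pos]
      · exact if_pos ho
      · exact ⟨capOriented_restrictBead_middleSign g.isCap ho,
          capStandard_restrictBead_middleSign g.isCap⟩
    · intro nu' _ hne
      by_contra h
      exact hne (Coset.ext_signVec ((key nu' h).2.trans hnu.symm))
    · simp
  · rw [Finset.sum_eq_zero]
    · exact if_neg ho
    · intro nu _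
      by_contra h
      exact ho (key nu h).1

end factorisation

end TypeC

theorem mainTheorem7 (n : ℕ) (hn : 2 ≤ n) (R : TypeC.ReducedPaths n)
    (r : TypeC.Coset n → List (Fin n))
    (hr : ∀ mu : TypeC.Coset n, TypeC.IsReducedExpr (r mu) mu.1) :
    TypeC.lightLeaves R = TypeC.matrixN r * TypeC.matrixB r := by
  ext1 lam mu
  rw [TypeC.lightLeaves_eq_northWeight R hr, Matrix.mul_apply, TypeC.northWeight_eq_sum hr]
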